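/- Let $\Bbbk$ be a field. For a symmetric operad $\mathrm{Var}$ over $\Bbbk$ that is generated by one binary operation $e_1 = x_1x_2$ without symmetry (so $\mathrm{Var}(2)=V$ has basis $e_1$, $e_2=(12)e_1=x_2x_1$) with multilinear defining identities of degree $3$, let $\mathcal F_V(3)$ be the $12$-dimensional space of multilinear nonassociative polynomials in $x_1,x_2,x_3$ (the arity-$3$ component of the free operad on $V$), and let $R\subseteq\mathcal F_V(3)$ be the $S_3$-submodule generated by the defining identities, so that $\mathrm{Var}(3)=\mathcal F_V(3)/R$. Let $\mathrm{As}$ be the operad of associative algebras. The white Manin product $\mathrm{As}\circ\mathrm{Var}$ is the quadratic operad generated by $\mathrm{As}(2)\otimes \mathrm{Var}(2)$ with defining relations the kernel of the natural map $\mathcal F_{\mathrm{As}(2)\otimes \mathrm{Var}(2)}(3)\to\mathrm{As}(3)\otimes\mathrm{Var}(3)$. Its generators are \[ h_1=x_1\prec x_2=x_1x_2\otimes e_1,\qquad g_1=x_1\succ x_2=x_1x_2\otimes e_2,\qquad h_2=(12)h_1,\qquad g_2=(12)g_1 . \] We say that $\mathrm{Var}$ admits a nonsymmetric version if \[ (\mathrm{As}\circ\mathrm{Var})\big/\{g_1-h_2=0,\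 g_2-h_1=0\}\;\cong\;\mathrm{Var} \] as symmetric operads. We say that an element of $\mathcal F_V(3)$ is of the form (T) if it is \[ \sum_{k,l}\alpha_{k,l}\,(x_3\circ_k x_2)\circ_l x_1+\beta_{k,l}\,(x_1\circ_k x_2)\circ_l x_3,\qquad \alpha_{k,l},\beta_{k,l}\in\Bbbk, \] where $\circ_k,\circ_l$ run over the multiplication and its opposite (only the two tree shapes in which $x_1$ or $x_3$ is joined last occur), and that the identities of $\mathrm{Var}$ can be written in the form (T) if $R$ is generated, as an $S_3$-module, by elements of the form (T). Then the following holds. 1. Let $\mathrm{Pre}\text{-}\mathrm{Lie}$ be the operad defined by the left-symmetric identity \[ (x_1x_2)x_3-x_1(x_2x_3)-(x_2x_1)x_3+x_2(x_1x_3)=0 . \] Its identity cannot be written in the form (T), and $\mathrm{Pre}\text{-}\mathrm{Lie}$ does not admit a nonsymmetric version. 2. Let $\mathrm{Nov}$ be the operad defined by the left-symmetric identity and the right-commutative identity $(x_1x_2)x_3=(x_1x_3)x_2$. Its defining identities can be written in the form (T): the $S_3$-module that they generate is also generated by \[ (x_1x_2)x_3-x_1(x_3x_2)-(x_3x_2)x_1+x_3(x_1x_2)\qquad\text{and}\qquad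 (x_2x_1)x_3-(x_2x_3)x_1, \] which are both of the form (T). The operad $\mathrm{Nov}$ admits a nonsymmetric version. -/

import Mathlib

universe u v w

open scoped TensorProduct

/-! ### Bijections used to relabel the inputs of compositions -/

/-- `A ⊔ {*} ≃ Option A`, the point `*` going to `none`. -/
def sumUnitEquiv (A : Type) : A ⊕ Unit ≃ Option A where
  toFun := fun | Sum.inl a => some a | Sum.inr _ => none
  invFun := fun | some a => Sum.inl a | none => Sum.inr ()
  left_inv := by rintro (a | a) <;> rfl
  right_inv := by rintro (_ | a) <;> rfl

/-- `{*} ≃ Option ∅`. -/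
def unitOptionEquiv : Unit ≃ Option Empty where
  toFun := fun _ => none
  invFun := fun _ => ()
  left_inv := fun _ => rfl
  right_inv := by rintro (_ | a); · rfl
                  · exact a.elim

/-- `A ⊔ (B ⊔ {*}) ≃ (A ⊔ B) ⊔ {*}`. -/
def sumOptionEquiv (A B : Type) : A ⊕ Option B ≃ Option (A ⊕ B) where
  toFun := fun
    | Sum.inl a => some (Sum.inl a)
    | Sum.inr (some b) => some (Sum.inr b)
    | Sum.inr none => none
  invFun := fun
    | some (Sum.inl a) => Sum.inl a
    | some (Sum.inr b) => Sum.inr (some b)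
    | none => Sum.inr none
  left_inv := by rintro (a | (_ | b)) <;> rfl
  right_inv := by rintro (_ | (a | b)) <;> rfl

/-- `(A ⊔ {*}) ⊔ B ≃ (A ⊔ B) ⊔ {*}`. -/
def optionSumEquiv (A B : Type) : Option A ⊕ B ≃ Option (A ⊕ B) where
  toFun := fun
    | Sum.inl (some a) => some (Sum.inl a)
    | Sum.inl none => none
    | Sum.inr b => some (Sum.inr b)
  invFun := fun
    | some (Sum.inl a) => Sum.inl (some a)
    | some (Sum.inr b) => Sum.inr b
    | none => Sum.inl none
  left_inv := by rintro ((_ | a) | b) <;> rfl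
  right_inv := by rintro (_ | (a | b)) <;> rfl

/-- `(A ⊔ B) ⊔ C ≃ (A ⊔ C) ⊔ B`. -/
def sumRightCommEquiv (A B C : Type) : (A ⊕ B) ⊕ C ≃ (A ⊕ C) ⊕ B where
  toFun := fun
    | Sum.inl (Sum.inl a) => Sum.inl (Sum.inl a)
    | Sum.inl (Sum.inr b) => Sum.inr b
    | Sum.inr c => Sum.inl (Sum.inr c)
  invFun := fun
    | Sum.inl (Sum.inl a) => Sum.inl (Sum.inl a)
    | Sum.inl (Sum.inr c) => Sum.inr c
    | Sum.inr b => Sum.inl (Sum.inr b)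
  left_inv := by rintro ((a | b) | c) <;> rfl
  right_inv := by rintro ((a | c) | b) <;> rfl

/-- The involution of `(A ⊔ {*}) ⊔ {*}` that exchanges the two added points. -/
def optionSwapEquiv (A : Type) : Option (Option A) ≃ Option (Option A) where
  toFun := fun
    | none => some none
    | some none => none
    | some (some a) => some (some a)
  invFun := fun
    | none => some none
    | some none => none
    | some (some a) => some (some a)
  left_inv := by rintro (_ | (_ | a)) <;> rfl
  right_inv := by rintro (_ | (_ | a)) <;> rfl

/-! ### Symmetric operads -/

/-- A symmetric operad in vector spaces over `k`, in coordinate-free form: a functor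
`A ↦ P(A)` from finite sets and bijections to vector spaces, with a unit in `P({*})` and
partial compositions.  The space `P.obj (Fin n)` is the `n`-th component `P(n)`, on which the group
`S_n = Equiv.Perm (Fin n)` acts through `map`.  In `comp p q` the operation `q` is inserted into
the input `none` of `p`; insertion into another input is obtained through `map`. -/
structure SymmOperad (k : Type u) [Field k] where
  obj : (A : Type) → [Finite A] → Type v
  [addCommGroup : ∀ (A : Type) [Finite A], AddCommGroup (obj A)]
  [module : ∀ (A : Type) [Finite A], Module k (obj A)]
  map : ∀ {A B : Type} [Finite A] [Finite B], A ≃ B → (obj A →ₗ[k] obj B)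
  one : obj Unit
  comp : ∀ {A B : Type} [Finite A] [Finite B], obj (Option A) →ₗ[k] obj B →ₗ[k] obj (A ⊕ B)
  map_refl : ∀ {A : Type} [Finite A] (p : obj A), map (Equiv.refl A) p = p
  map_trans : ∀ {A B C : Type} [Finite A] [Finite B] [Finite C] (e : A ≃ B) (f : B ≃ C)
    (p : obj A), map (e.trans f) p = map f (map e p)
  /-- equivariance of the partial composition -/
  map_comp : ∀ {A A' B B' : Type} [Finite A] [Finite A'] [Finite B] [Finite B']
    (e : A ≃ A') (f : B ≃ B') (p : obj (Option A)) (q : obj B),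
    map (Equiv.sumCongr e f) (comp p q) = comp (map (Equiv.optionCongr e) p) (map f q)
  /-- inserting the unit into `p` gives `p` -/
  comp_one : ∀ {A : Type} [Finite A] (p : obj (Option A)),
    map (sumUnitEquiv A) (comp p one) = p
  /-- inserting `q` into the unit gives `q` -/
  one_comp : ∀ {B : Type} [Finite B] (q : obj B),
    map (Equiv.emptySum Empty B) (comp (map unitOptionEquiv one) q) = q
  /-- sequential associativity: `(p ∘ q) ∘ r = p ∘ (q ∘ r)`, where `r` is inserted into `q` -/
  comp_assoc : ∀ {A B C : Type} [Finite A] [Finite B] [Finite C]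
    (p : obj (Option A)) (q : obj (Option B)) (r : obj C),
    map (Equiv.sumAssoc A B C) (comp (map (sumOptionEquiv A B) (comp p q)) r)
      = comp p (comp q r)
  /-- parallel associativity: insertions into two different inputs of `p` commute -/
  comp_comm : ∀ {A B C : Type} [Finite A] [Finite B] [Finite C]
    (p : obj (Option (Option A))) (q : obj B) (r : obj C),
    map (sumRightCommEquiv A B C) (comp (map (optionSumEquiv A B) (comp p q)) r)
      = comp (map (optionSumEquiv A C) (comp (map (optionSwapEquiv A) p) r)) q

namespace SymmOperad

attribute [instance] SymmOperad.addCommGroup SymmOperad.module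

variable {k : Type u} [Field k]

/-- An isomorphism of symmetric operads. -/
structure Iso (P : SymmOperad.{u, v} k) (Q : SymmOperad.{u, w} k) where
  equiv : ∀ (A : Type) [Finite A], P.obj A ≃ₗ[k] Q.obj A
  equiv_map : ∀ {A B : Type} [Finite A] [Finite B] (e : A ≃ B) (p : P.obj A),
    equiv B (P.map e p) = Q.map e (equiv A p)
  equiv_one : equiv Unit P.one = Q.one
  equiv_comp : ∀ {A B : Type} [Finite A] [Finite B] (p : P.obj (Option A)) (q : P.obj B),
    equiv (A ⊕ B) (P.comp p q) = Q.comp (equiv (Option A) p) (equiv B q)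

/-- An operadic ideal: a family of subspaces, stable under relabelling of inputs and under
composition with arbitrary operations on either side. -/
structure OperadIdeal (P : SymmOperad.{u, v} k) where
  carrier : ∀ (A : Type) [Finite A], Submodule k (P.obj A)
  map_mem : ∀ {A B : Type} [Finite A] [Finite B] (e : A ≃ B) (p : P.obj A),
    p ∈ carrier A → P.map e p ∈ carrier B
  comp_mem_left : ∀ {A B : Type} [Finite A] [Finite B] (p : P.obj (Option A)) (q : P.obj B),
    p ∈ carrier (Option A) → P.comp p q ∈ carrier (A ⊕ B)
  comp_mem_right : ∀ {A B : Type} [Finite A] [Finite B] (p : P.obj (Option A)) (q : P.obj B),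
    q ∈ carrier B → P.comp p q ∈ carrier (A ⊕ B)

/-- The operadic ideal generated by a set `S` of operations of arity `n`: the intersection of all
operadic ideals that contain `S`. -/
def idealSpan (P : SymmOperad.{u, v} k) {n : ℕ} (S : Set (P.obj (Fin n))) : OperadIdeal P where
  carrier := fun A _ => ⨅ (I : OperadIdeal P) (_ : S ⊆ I.carrier (Fin n)), I.carrier A
  map_mem := by
    intro A B _ _ e p hp
    simp only [Submodule.mem_iInf] at hp ⊢
    exact fun I hI => I.map_mem e p (hp I hI)
  comp_mem_left := by
    intro A B _ _ p q hp
    simp only [Submodule.mem_iInf] at hp ⊢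
    exact fun I hI => I.comp_mem_left p q (hp I hI)
  comp_mem_right := by
    intro A B _ _ p q hp
    simp only [Submodule.mem_iInf] at hp ⊢
    exact fun I hI => I.comp_mem_right p q (hp I hI)

/-- The quotient of an operad by an operadic ideal. -/
def quotient (P : SymmOperad.{u, v} k) (I : OperadIdeal P) : SymmOperad.{u, v} k where
  obj := fun A _ => P.obj A ⧸ I.carrier A
  map := fun {A B} _ _ e => Submodule.mapQ (I.carrier A) (I.carrier B) (P.map e) (I.map_mem e)
  one := Submodule.Quotient.mk P.one
  comp := fun {A B} _ _ => LinearMap.liftQ₂ (I.carrier (Option A)) (I.carrier B)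
    (P.comp.compr₂ (I.carrier (A ⊕ B)).mkQ)
    (by
      intro p hp
      ext q
      simpa using I.comp_mem_left p q hp)
    (by
      intro q hq
      ext p
      simpa using I.comp_mem_right p q hq)
  map_refl := by
    rintro A _ ⟨p⟩
    exact congrArg Submodule.Quotient.mk (P.map_refl p)
  map_trans := by
    rintro A B C _ _ _ e f ⟨p⟩
    exact congrArg Submodule.Quotient.mk (P.map_trans e f p)
  map_comp := by
    rintro A A' B B' _ _ _ _ e f ⟨p⟩ ⟨q⟩
    exact congrArg Submodule.Quotient.mk (P.map_comp e f p q)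
  comp_one := by
    rintro A _ ⟨p⟩
    exact congrArg Submodule.Quotient.mk (P.comp_one p)
  one_comp := by
    rintro B _ ⟨q⟩
    exact congrArg Submodule.Quotient.mk (P.one_comp q)
  comp_assoc := by
    rintro A B C _ _ _ ⟨p⟩ ⟨q⟩ ⟨r⟩
    exact congrArg Submodule.Quotient.mk (P.comp_assoc p q r)
  comp_comm := by
    rintro A B C _ _ _ ⟨p⟩ ⟨q⟩ ⟨r⟩
    exact congrArg Submodule.Quotient.mk (P.comp_comm p q r)

end SymmOperad

/-! ### Multilinear nonassociative monomials -/

/-- Nonassociative monomials in the variables `X`, built with the binary operations `Op`: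
planar binary trees with vertices labelled by `Op` and leaves labelled by `X`. -/
inductive OpTree (Op : Type) (X : Type) : Type
  | leaf : X → OpTree Op X
  | node : Op → OpTree Op X → OpTree Op X → OpTree Op X

namespace OpTree

variable {Op Op' X Y Z A B C : Type}

/-- The list of variables of a monomial, from left to right. -/
def leaves : OpTree Op X → List X
  | leaf x => [x]
  | node _ l r => l.leaves ++ r.leaves

/-- Substitution of monomials for the variables. -/
def bind (f : X → OpTree Op Y) : OpTree Op X → OpTree Op Y
  | leaf x => f x
  | node o l r => node o (l.bind f) (r.bind f)

/-- Renaming of the variables. -/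
def rename (f : X → Y) (t : OpTree Op X) : OpTree Op Y := t.bind fun x => leaf (f x)

/-- Insertion of `s` for the variable `none` of `t`. -/
def graft (t : OpTree Op (Option A)) (s : OpTree Op B) : OpTree Op (A ⊕ B) :=
  t.bind fun
    | none => s.rename Sum.inr
    | some a => leaf (Sum.inl a)

/-- A monomial in the variables `A` is multilinear if each variable occurs exactly once. -/
def IsMultilinear (t : OpTree Op A) : Prop := t.leaves.Nodup ∧ ∀ a, a ∈ t.leaves

instance [DecidableEq A] [Fintype A] (t : OpTree Op A) : Decidable t.IsMultilinear :=
  inferInstanceAs (Decidable (_ ∧ _))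

theorem leaves_bind (f : X → OpTree Op Y) (t : OpTree Op X) :
    (t.bind f).leaves = t.leaves.flatMap fun x => (f x).leaves := by
  induction t with
  | leaf x => simp [bind, leaves]
  | node o l r hl hr => simp [bind, leaves, hl, hr]

theorem leaves_rename (f : X → Y) (t : OpTree Op X) :
    (t.rename f).leaves = t.leaves.map f := by
  induction t with
  | leaf x => simp [rename, bind, leaves]
  | node o l r hl hr => simpa [rename, bind, leaves] using congrArg₂ (· ++ ·) hl hr

theorem bind_bind (f : X → OpTree Op Y) (g : Y → OpTree Op Z) (t : OpTree Op X) :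
    (t.bind f).bind g = t.bind fun x => (f x).bind g := by
  induction t with
  | leaf x => rfl
  | node o l r hl hr => simp [bind, hl, hr]

theorem bind_leaf (t : OpTree Op X) : t.bind leaf = t := by
  induction t with
  | leaf x => rfl
  | node o l r hl hr => simp [bind, hl, hr]

theorem isMultilinear_leaf : (leaf () : OpTree Op Unit).IsMultilinear := by
  simp [IsMultilinear, leaves]

theorem IsMultilinear.rename {t : OpTree Op A} (ht : t.IsMultilinear) (e : A ≃ B) :
    (t.rename e).IsMultilinear := by
  refine ⟨?_, fun b => ?_⟩
  · rw [leaves_rename]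
    exact ht.1.map e.injective
  · rw [leaves_rename]
    exact List.mem_map.2 ⟨e.symm b, ht.2 _, by simp⟩

theorem IsMultilinear.graft {t : OpTree Op (Option A)} {s : OpTree Op B}
    (ht : t.IsMultilinear) (hs : s.IsMultilinear) : (t.graft s).IsMultilinear := by
  refine ⟨?_, ?_⟩
  · rw [OpTree.graft, leaves_bind, List.nodup_flatMap]
    refine ⟨?_, ?_⟩
    · rintro (_ | a) _
      · simpa [leaves_rename] using hs.1.map Sum.inr_injective
      · simp [leaves]
    · refine List.Nodup.pairwise_of_forall_ne ht.1 ?_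
      rintro (_ | a) _ (_ | b) _ hab
      · exact (hab rfl).elim
      · simp [leaves_rename, leaves, Function.onFun]
      · simp [leaves_rename, leaves, Function.onFun]
      · have : b ≠ a := fun h => hab (by rw [h])
        simpa [leaves, Function.onFun] using this
  · rw [OpTree.graft, leaves_bind]
    rintro (a | b)
    · exact List.mem_flatMap.2 ⟨some a, ht.2 _, by simp [leaves]⟩
    · exact List.mem_flatMap.2 ⟨none, ht.2 _, by simp [leaves_rename, hs.2]⟩

end OpTree

/-- The multilinear monomials in the variables `A`. -/
def MultMonomial (Op : Type) (A : Type) : Type := {t : OpTree Op A // t.IsMultilinear}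

namespace MultMonomial

variable {Op A B : Type}

def one : MultMonomial Op Unit := ⟨OpTree.leaf (), OpTree.isMultilinear_leaf⟩

def rename (e : A ≃ B) (t : MultMonomial Op A) : MultMonomial Op B :=
  ⟨t.1.rename e, t.2.rename e⟩

def graft (t : MultMonomial Op (Option A)) (s : MultMonomial Op B) : MultMonomial Op (A ⊕ B) :=
  ⟨t.1.graft s.1, t.2.graft s.2⟩

end MultMonomial

/-! ### Free operads and binary quadratic operads -/

theorem MultMonomial.ext_val {Op A : Type} {s t : MultMonomial Op A} (h : s.1 = t.1) : s = t :=
  Subtype.ext h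

/-- Linear extension of the relabelling of monomials. -/
noncomputable def freeMap (k : Type u) [Field k] (Op : Type) {A B : Type} (e : A ≃ B) :
    (MultMonomial Op A →₀ k) →ₗ[k] (MultMonomial Op B →₀ k) :=
  Finsupp.lmapDomain k k (MultMonomial.rename e)

/-- Bilinear extension of the grafting of monomials. -/
noncomputable def freeComp (k : Type u) [Field k] (Op : Type) (A B : Type) :
    (MultMonomial Op (Option A) →₀ k) →ₗ[k] (MultMonomial Op B →₀ k) →ₗ[k]
      (MultMonomial Op (A ⊕ B) →₀ k) :=
  Finsupp.linearCombination k fun t => Finsupp.lmapDomain k k (MultMonomial.graft (B := B) t)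

theorem freeMap_single {k : Type u} [Field k] {Op A B : Type} (e : A ≃ B)
    (t : MultMonomial Op A) (c : k) :
    freeMap k Op e (Finsupp.single t c) = Finsupp.single (t.rename e) c := by
  simp [freeMap]

theorem freeComp_single {k : Type u} [Field k] {Op A B : Type}
    (t : MultMonomial Op (Option A)) (s : MultMonomial Op B) (c d : k) :
    freeComp k Op A B (Finsupp.single t c) (Finsupp.single s d)
      = Finsupp.single (t.graft s) (c * d) := by
  simp [freeComp]

/-- The free symmetric operad on binary operations `o ∈ Op` without symmetry, that is, on the
`S_2`-module `V` in arity 2 with basis the operations `o` and `(12) o`, `o ∈ Op`.  Its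
component on `A` is the space of multilinear nonassociative polynomials in the variables `A`, and
composition is substitution. -/
noncomputable def freeOperad (k : Type u) [Field k] (Op : Type) : SymmOperad.{u, u} k where
  obj := fun A _ => MultMonomial Op A →₀ k
  map := fun e => freeMap k Op e
  one := Finsupp.single MultMonomial.one 1
  comp := fun {A B} _ _ => freeComp k Op A B
  map_refl := by
    intro A _ p
    induction p using Finsupp.induction_linear with
    | zero => simp
    | add p q hp hq => rw [map_add, hp, hq]
    | single t c =>
      rw [freeMap_single]
      congr 1
      exact MultMonomial.ext_val (OpTree.bind_leaf _)
  map_trans := by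
    intro A B C _ _ _ e f p
    induction p using Finsupp.induction_linear with
    | zero => simp
    | add p q hp hq => simp only [map_add, hp, hq]
    | single t c =>
      simp only [freeMap_single]
      congr 1
      apply MultMonomial.ext_val
      simp only [MultMonomial.rename, OpTree.rename, OpTree.bind_bind]
      rfl
  map_comp := by
    intro A A' B B' _ _ _ _ e f p q
    induction p using Finsupp.induction_linear with
    | zero => simp
    | add p p' hp hp' => simp only [map_add, LinearMap.add_apply, hp, hp']
    | single t c =>
      induction q using Finsupp.induction_linear with
      | zero => simp
      | add q q' hq hq' => simp only [map_add, hq, hq']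
      | single s d =>
        simp only [freeMap_single, freeComp_single]
        congr 1
        apply MultMonomial.ext_val
        simp only [MultMonomial.rename, MultMonomial.graft, OpTree.rename, OpTree.graft,
          OpTree.bind_bind]
        congr 1
        funext x
        rcases x with _ | a <;> simp [OpTree.bind, OpTree.bind_bind]
  comp_one := by
    intro A _ p
    induction p using Finsupp.induction_linear with
    | zero => simp
    | add p p' hp hp' => simp only [map_add, LinearMap.add_apply, hp, hp']
    | single t c =>
      simp only [freeMap_single, freeComp_single, mul_one]
      congr 1
      apply MultMonomial.ext_val
      simp only [MultMonomial.rename, MultMonomial.graft, OpTree.rename, OpTree.graft,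
        OpTree.bind_bind, MultMonomial.one]
      conv_rhs => rw [← OpTree.bind_leaf t.1]
      congr 1
      funext x
      rcases x with _ | a <;> rfl
  one_comp := by
    intro B _ q
    induction q using Finsupp.induction_linear with
    | zero => simp
    | add q q' hq hq' => simp only [map_add, hq, hq']
    | single s d =>
      simp only [freeMap_single, freeComp_single, one_mul]
      congr 1
      apply MultMonomial.ext_val
      simp only [MultMonomial.rename, MultMonomial.graft, OpTree.rename, OpTree.graft,
        MultMonomial.one, OpTree.bind]
      conv_rhs => rw [← OpTree.bind_leaf s.1]
      exact OpTree.bind_bind _ _ _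
  comp_assoc := by
    intro A B C _ _ _ p q r
    induction p using Finsupp.induction_linear with
    | zero => simp
    | add p p' hp hp' => simp only [map_add, LinearMap.add_apply, hp, hp']
    | single t c =>
      induction q using Finsupp.induction_linear with
      | zero => simp
      | add q q' hq hq' => simp only [map_add, LinearMap.add_apply, hq, hq']
      | single s d =>
        induction r using Finsupp.induction_linear with
        | zero => simp
        | add r r' hr hr' => simp only [map_add, hr, hr']
        | single w b =>
          simp only [freeMap_single, freeComp_single, mul_assoc]
          congr 1
          apply MultMonomial.ext_val
          simp only [MultMonomial.rename, MultMonomial.graft, OpTree.rename, OpTree.graft,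
            OpTree.bind_bind]
          congr 1
          funext x
          rcases x with _ | a
          · simp only [OpTree.bind_bind]
            congr 1
            funext y
            rcases y with _ | y <;>
              simp [OpTree.bind, OpTree.bind_bind, sumOptionEquiv]
          · rfl
  comp_comm := by
    intro A B C _ _ _ p q r
    induction p using Finsupp.induction_linear with
    | zero => simp
    | add p p' hp hp' => simp only [map_add, LinearMap.add_apply, hp, hp']
    | single t c =>
      induction q using Finsupp.induction_linear with
      | zero => simp
      | add q q' hq hq' => simp only [map_add, LinearMap.add_apply, hq, hq']
      | single s d =>
        induction r using Finsupp.induction_linear with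
        | zero => simp
        | add r r' hr hr' => simp only [map_add, LinearMap.add_apply, hr, hr']
        | single w b =>
          simp only [freeMap_single, freeComp_single, mul_right_comm c d b]
          congr 1
          apply MultMonomial.ext_val
          simp only [MultMonomial.rename, MultMonomial.graft, OpTree.rename, OpTree.graft,
            OpTree.bind_bind]
          congr 1
          funext x
          rcases x with _ | (_ | a) <;>
            simp [OpTree.bind, OpTree.bind_bind, optionSumEquiv, sumRightCommEquiv,
              optionSwapEquiv]

/-- The monomial `t` as an element of the free operad. -/
noncomputable def mono (k : Type u) [Field k] {Op : Type} {n : ℕ} (t : OpTree Op (Fin n))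
    (h : t.IsMultilinear) : (freeOperad k Op).obj (Fin n) :=
  Finsupp.single (⟨t, h⟩ : MultMonomial Op (Fin n)) (1 : k)

/-- The binary quadratic operad generated by binary operations `Op` (without symmetry) with
the defining relations `R` in arity 3: the free operad modulo the operadic ideal generated
by `R`. -/
noncomputable def quadraticOperad (k : Type u) [Field k] {Op : Type}
    (R : Set ((freeOperad k Op).obj (Fin 3))) : SymmOperad.{u, u} k :=
  (freeOperad k Op).quotient ((freeOperad k Op).idealSpan R)

/-- The class in the quadratic operad of an element of the free operad. -/
noncomputable def quadraticOperad.mk {k : Type u} [Field k] {Op : Type}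
    (R : Set ((freeOperad k Op).obj (Fin 3))) {n : ℕ} :
    (freeOperad k Op).obj (Fin n) →ₗ[k] (quadraticOperad k R).obj (Fin n) :=
  (((freeOperad k Op).idealSpan R).carrier (Fin n)).mkQ

/-! ### The white Manin product

For `V₁`, `V₂` with bases `{o, (12) o : o ∈ Op₁}` and `{o, (12) o : o ∈ Op₂}` the space `V₁ ⊗ V₂`
with the diagonal action of `S_2` has the basis
`{g, (12) g : g ∈ Op₁ × Op₂ × Bool}`, where `(o₁, o₂, false)` stands for `o₁ ⊗ o₂` and
`(o₁, o₂, true)` stands for `o₁ ⊗ (12) o₂`. -/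

/-- The first tensor factor of a monomial in the operations of `V₁ ⊗ V₂`. -/
def OpTree.fstFactor {Op₁ Op₂ X : Type} : OpTree (Op₁ × Op₂ × Bool) X → OpTree Op₁ X
  | .leaf x => .leaf x
  | .node (o, _, _) l r => .node o l.fstFactor r.fstFactor

/-- The second tensor factor of a monomial in the operations of `V₁ ⊗ V₂`. -/
def OpTree.sndFactor {Op₁ Op₂ X : Type} : OpTree (Op₁ × Op₂ × Bool) X → OpTree Op₂ X
  | .leaf x => .leaf x
  | .node (_, o, false) l r => .node o l.sndFactor r.sndFactor
  | .node (_, o, true) l r => .node o r.sndFactor l.sndFactor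

theorem OpTree.leaves_fstFactor {Op₁ Op₂ X : Type} (t : OpTree (Op₁ × Op₂ × Bool) X) :
    t.fstFactor.leaves = t.leaves := by
  induction t with
  | leaf x => rfl
  | node o l r hl hr => simp [fstFactor, leaves, hl, hr]

theorem OpTree.leaves_sndFactor {Op₁ Op₂ X : Type} (t : OpTree (Op₁ × Op₂ × Bool) X) :
    t.sndFactor.leaves.Perm t.leaves := by
  induction t with
  | leaf x => exact List.Perm.refl _
  | node o l r hl hr =>
    obtain ⟨o₁, o₂, _ | _⟩ := o
    · exact hl.append hr
    · exact (hr.append hl).trans List.perm_append_comm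

theorem OpTree.IsMultilinear.fstFactor {Op₁ Op₂ A : Type} {t : OpTree (Op₁ × Op₂ × Bool) A}
    (ht : t.IsMultilinear) : t.fstFactor.IsMultilinear := by
  simpa [OpTree.IsMultilinear, OpTree.leaves_fstFactor] using ht

theorem OpTree.IsMultilinear.sndFactor {Op₁ Op₂ A : Type} {t : OpTree (Op₁ × Op₂ × Bool) A}
    (ht : t.IsMultilinear) : t.sndFactor.IsMultilinear :=
  ⟨t.leaves_sndFactor.nodup_iff.2 ht.1, fun a => t.leaves_sndFactor.mem_iff.2 (ht.2 a)⟩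

/-- The natural map `F_{V₁ ⊗ V₂}(3) → P₁(3) ⊗ P₂(3)`, `P₁` and `P₂` being the quadratic operads
with the relations `R₁` and `R₂`. -/
noncomputable def whiteMap (k : Type u) [Field k] {Op₁ Op₂ : Type}
    (R₁ : Set ((freeOperad k Op₁).obj (Fin 3))) (R₂ : Set ((freeOperad k Op₂).obj (Fin 3))) :
    (freeOperad k (Op₁ × Op₂ × Bool)).obj (Fin 3) →ₗ[k]
      (quadraticOperad k R₁).obj (Fin 3) ⊗[k] (quadraticOperad k R₂).obj (Fin 3) :=
  Finsupp.linearCombination k fun t : MultMonomial (Op₁ × Op₂ × Bool) (Fin 3) =>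
    quadraticOperad.mk R₁ (mono k t.1.fstFactor t.2.fstFactor) ⊗ₜ[k]
      quadraticOperad.mk R₂ (mono k t.1.sndFactor t.2.sndFactor)

/-- The relations of the white Manin product: the kernel of
`F_{V₁ ⊗ V₂}(3) → P₁(3) ⊗ P₂(3)`. -/
noncomputable def whiteRelations (k : Type u) [Field k] {Op₁ Op₂ : Type}
    (R₁ : Set ((freeOperad k Op₁).obj (Fin 3))) (R₂ : Set ((freeOperad k Op₂).obj (Fin 3))) :
    Set ((freeOperad k (Op₁ × Op₂ × Bool)).obj (Fin 3)) :=
  {p | whiteMap k R₁ R₂ p = 0}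

/-- The white Manin product `P₁ ∘ P₂` of the quadratic operads with relations `R₁` and `R₂`: the
quadratic operad generated by `V₁ ⊗ V₂ = P₁(2) ⊗ P₂(2)` whose relations are the kernel of
`F_{V₁ ⊗ V₂}(3) → P₁(3) ⊗ P₂(3)`. -/
noncomputable def whiteProduct (k : Type u) [Field k] {Op₁ Op₂ : Type}
    (R₁ : Set ((freeOperad k Op₁).obj (Fin 3))) (R₂ : Set ((freeOperad k Op₂).obj (Fin 3))) :
    SymmOperad.{u, u} k :=
  quadraticOperad k (whiteRelations k R₁ R₂)

/-! ### Operads with one binary operation `x y`, and their nonsymmetric versions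

In arity 3 the variables `x₁, x₂, x₃` are `0, 1, 2 : Fin 3`. -/

/-- The operadic monomial `(x_a x_b) x_c`. -/
noncomputable def leftMono (k : Type u) [Field k] (a b c : Fin 3)
    (h : (OpTree.node () (.node () (.leaf a) (.leaf b)) (.leaf c)).IsMultilinear := by decide) :
    (freeOperad k Unit).obj (Fin 3) :=
  mono k (.node () (.node () (.leaf a) (.leaf b)) (.leaf c)) h

/-- The operadic monomial `x_a (x_b x_c)`. -/
noncomputable def rightMono (k : Type u) [Field k] (a b c : Fin 3)
    (h : (OpTree.node () (.leaf a) (.node () (.leaf b) (.leaf c))).IsMultilinear := by decide) :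
    (freeOperad k Unit).obj (Fin 3) :=
  mono k (.node () (.leaf a) (.node () (.leaf b) (.leaf c))) h

/-- The relation `(x₁ x₂) x₃ = x₁ (x₂ x₃)` of the operad `As`. -/
noncomputable def asRelations (k : Type u) [Field k] : Set ((freeOperad k Unit).obj (Fin 3)) :=
  {leftMono k 0 1 2 - rightMono k 0 1 2}

/-- The left-symmetric identity `(x₁ x₂) x₃ - x₁ (x₂ x₃) - (x₂ x₁) x₃ + x₂ (x₁ x₃) = 0`. -/
noncomputable def leftSymmetric (k : Type u) [Field k] : (freeOperad k Unit).obj (Fin 3) :=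
  leftMono k 0 1 2 - rightMono k 0 1 2 - leftMono k 1 0 2 + rightMono k 1 0 2

/-- The right-commutative identity `(x₁ x₂) x₃ - (x₁ x₃) x₂ = 0`. -/
noncomputable def rightCommutative (k : Type u) [Field k] : (freeOperad k Unit).obj (Fin 3) :=
  leftMono k 0 1 2 - leftMono k 0 2 1

/-- The defining relations of the pre-Lie operad. -/
noncomputable def preLieRelations (k : Type u) [Field k] : Set ((freeOperad k Unit).obj (Fin 3)) :=
  {leftSymmetric k}

/-- The defining relations of the Novikov operad. -/
noncomputable def novikovRelations (k : Type u) [Field k] :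
    Set ((freeOperad k Unit).obj (Fin 3)) :=
  {leftSymmetric k, rightCommutative k}

/-- A binary operation of `As ∘ Var` applied to `x_a, x_b`.  For `flip = false` it is
`x_a ≺ x_b = x_a x_b ⊗ (x_a ∘ x_b)`, and for `flip = true` it is
`x_a ≻ x_b = x_a x_b ⊗ (x_b ∘ x_a)`. -/
noncomputable def asOp (k : Type u) [Field k] (R : Set ((freeOperad k Unit).obj (Fin 3)))
    (flip : Bool) (a b : Fin 2)
    (h : (OpTree.node ((), (), flip) (.leaf a) (.leaf b)).IsMultilinear) :
    (whiteProduct k (asRelations k) R).obj (Fin 2) :=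
  quadraticOperad.mk (whiteRelations k (asRelations k) R)
    (mono k (.node ((), (), flip) (.leaf a) (.leaf b)) h)

/-- The elements `g₁ - h₂` and `g₂ - h₁` of `(As ∘ Var)(2)`, where `g₁ = x₁ ≻ x₂`,
`g₂ = x₂ ≻ x₁`, `h₁ = x₁ ≺ x₂` and `h₂ = x₂ ≺ x₁`. -/
noncomputable def identification (k : Type u) [Field k]
    (R : Set ((freeOperad k Unit).obj (Fin 3))) :
    Set ((whiteProduct k (asRelations k) R).obj (Fin 2)) :=
  {asOp k R true 0 1 (by decide) - asOp k R false 1 0 (by decide),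
    asOp k R true 1 0 (by decide) - asOp k R false 0 1 (by decide)}

/-- The operad `Var` with one binary operation and the defining relations `R` admits a nonsymmetric
version: `(As ∘ Var) / {g₁ - h₂ = 0, g₂ - h₁ = 0} ≅ Var`. -/
def AdmitsNonsymmetricVersion (k : Type u) [Field k]
    (R : Set ((freeOperad k Unit).obj (Fin 3))) : Prop :=
  Nonempty (SymmOperad.Iso
    ((whiteProduct k (asRelations k) R).quotient
      ((whiteProduct k (asRelations k) R).idealSpan (identification k R)))
    (quadraticOperad k R))

/-! ### Identities written through the two outer tree shapes -/

/-- The `S_3`-submodule of `F_V(3)` generated by a set `S`. -/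
noncomputable def s3Span (k : Type u) [Field k] {Op : Type}
    (S : Set ((freeOperad k Op).obj (Fin 3))) : Submodule k ((freeOperad k Op).obj (Fin 3)) :=
  Submodule.span k (⋃ e : Equiv.Perm (Fin 3), (freeOperad k Op).map e '' S)

/-- The space spanned by the monomials of the tree shape in which all inputs but `x_c` are joined
first and `x_c` is joined last, on either side.  For `c = 2` this is `V ⊗ V`, spanned by all
`(x₁ ∘_k x₂) ∘_l x₃`; for `c = 0` it is `(13) (V ⊗ V)`, spanned by all `(x₃ ∘_k x₂) ∘_l x₁`. -/
noncomputable def treeShape (k : Type u) [Field k] (Op : Type) (c : Fin 3) :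
    Submodule k ((freeOperad k Op).obj (Fin 3)) :=
  Submodule.span k {p | ∃ (o : Op) (u t : OpTree Op (Fin 3)) (h : t.IsMultilinear),
    (t = .node o u (.leaf c) ∨ t = .node o (.leaf c) u) ∧ p = mono k t h}

/-- The elements `∑ α_{kl} (x₃ ∘_k x₂) ∘_l x₁ + β_{kl} (x₁ ∘_k x₂) ∘_l x₃` of `F_V(3)`. -/
noncomputable def outerShapes (k : Type u) [Field k] (Op : Type) :
    Submodule k ((freeOperad k Op).obj (Fin 3)) :=
  treeShape k Op 2 ⊔ treeShape k Op 0

/-- The identities `R` can be written using the two outer tree shapes only: they are equivalent to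
some set of identities of that form. -/
def WritableInOuterShapes (k : Type u) [Field k] {Op : Type}
    (R : Set ((freeOperad k Op).obj (Fin 3))) : Prop :=
  ∃ S : Set ((freeOperad k Op).obj (Fin 3)),
    S ⊆ outerShapes k Op ∧ s3Span k S = s3Span k R

/-- The identities `(x₁ x₂) x₃ - x₁ (x₃ x₂) - (x₃ x₂) x₁ + x₃ (x₁ x₂) = 0` and
`(x₂ x₁) x₃ - (x₂ x₃) x₁ = 0`. -/
noncomputable def novikovOuterRelations (k : Type u) [Field k] :
    Set ((freeOperad k Unit).obj (Fin 3)) :=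
  {leftMono k 0 1 2 - rightMono k 0 2 1 - leftMono k 2 1 0 + rightMono k 2 0 1,
    leftMono k 1 0 2 - leftMono k 1 2 0}

/-! The operad `As` remembers exactly the left-to-right order of the variables. Taking word
coefficients in the first tensor factor therefore splits every relation of `As ∘ Var` into parts
with a fixed order of the variables. Each part becomes a relation of `Var` once `x ≺ y` is read as
`x y` and `x ≻ y` as `y x` (`mk_sndHom_wordPart`). In a tree whose leaves spell the word `x₁ x₂ x₃`,
the variable joined last is `x₁` or `x₃`, never the middle one, and exchanging branches does not
change this. So the parts are relations of the form (T), up to renaming variables. Imposing `x ≻ y =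
y ≺ x` turns the white product into the free operad on one operation modulo these readings. Hence
`Var` is recovered as soon as its relations are generated by elements of the form (T) that lift to
relations of `As ∘ Var` (`admitsNonsymmetricVersion_of_s3Span`).

For Novikov algebras, right commutativity converts left symmetry into a relation without trees that
join `x₂` last (`s3Span_novikovOuterRelations`). Both new generators lift, because monomials of `≺`
and `≻` spelling `x₁ x₂ x₃` all have the same associative first factor.

For pre-Lie algebras, a consequence of left symmetry in degree 3 is determined by the coefficients
of the monomials `(a b) c`: they are antisymmetric in `a, b`, and the coefficient of `a (b c)` is
the opposite of that of `(a b) c`. If no monomial joins a chosen variable `m` last, these symmetries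
make every coefficient vanish (`eq_zero_of_mem_avoidSpace`). So there is no nonzero relation of the
form (T), and the relations of `As ∘ Pre-Lie` all read as zero. The identified quotient then maps
onto the free operad. An arbitrary isomorphism with the pre-Lie operad, not assumed to respect
generators, would give a surjection from a proper quotient of the finite-dimensional space `F_V(3)`
onto `F_V(3)`, which is impossible.

The bound on the pre-Lie relations needs the arity-3 component of the generated operadic ideal. The
ideal is an intersection, so it is bounded from above by an explicit ideal, `thresholdIdeal`. -/

namespace SymmOperad

/-! ### Morphisms, kernels and quotients of operads -/

variable {k : Type u} [Field k]

/-- A morphism of symmetric operads. -/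
structure Hom (P : SymmOperad.{u, v} k) (Q : SymmOperad.{u, w} k) where
  app : ∀ (A : Type) [Finite A], P.obj A →ₗ[k] Q.obj A
  app_map : ∀ {A B : Type} [Finite A] [Finite B] (e : A ≃ B) (p : P.obj A),
    app B (P.map e p) = Q.map e (app A p)
  app_one : app Unit P.one = Q.one
  app_comp : ∀ {A B : Type} [Finite A] [Finite B] (p : P.obj (Option A)) (q : P.obj B),
    app (A ⊕ B) (P.comp p q) = Q.comp (app (Option A) p) (app B q)

namespace Hom

universe v₁ v₂ v₃

variable {P : SymmOperad.{u, v₁} k} {Q : SymmOperad.{u, v₂} k} {T : SymmOperad.{u, v₃} k}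

/-- Composition of morphisms, `f` being applied first. -/
def trans (f : Hom P Q) (g : Hom Q T) : Hom P T where
  app A _ := g.app A ∘ₗ f.app A
  app_map e p := by simp [f.app_map, g.app_map]
  app_one := by simp [f.app_one, g.app_one]
  app_comp p q := by simp [f.app_comp, g.app_comp]

/-- The kernel of a morphism of operads. -/
def ker (f : Hom P Q) : OperadIdeal P where
  carrier A _ := LinearMap.ker (f.app A)
  map_mem e p hp := by
    rw [LinearMap.mem_ker] at hp ⊢
    rw [f.app_map, hp, map_zero]
  comp_mem_left p q hp := by
    rw [LinearMap.mem_ker] at hp ⊢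
    rw [f.app_comp, hp, map_zero, LinearMap.zero_apply]
  comp_mem_right p q hq := by
    rw [LinearMap.mem_ker] at hq ⊢
    rw [f.app_comp, hq, map_zero]

/-- The projection onto a quotient operad. -/
def quotientMk (I : OperadIdeal P) : Hom P (P.quotient I) where
  app A _ := (I.carrier A).mkQ
  app_map _ _ := rfl
  app_one := rfl
  app_comp _ _ := rfl

theorem quotientMk_surjective (I : OperadIdeal P) (A : Type) [Finite A] :
    Function.Surjective ((quotientMk I).app A) :=
  Submodule.mkQ_surjective _

theorem quotientMk_eq_zero_iff (I : OperadIdeal P) {A : Type} [Finite A] (p : P.obj A) :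
    (quotientMk I).app A p = 0 ↔ p ∈ I.carrier A :=
  Submodule.Quotient.mk_eq_zero _

/-- The morphism from a quotient operad induced by a morphism that vanishes on the ideal. -/
def lift (f : Hom P Q) (I : OperadIdeal P)
    (h : ∀ (A : Type) [Finite A], I.carrier A ≤ f.ker.carrier A) : Hom (P.quotient I) Q where
  app A _ := (I.carrier A).liftQ (f.app A) (h A)
  app_map := by
    rintro A B _ _ e ⟨p⟩
    exact f.app_map e p
  app_one := f.app_one
  app_comp := by
    rintro A B _ _ ⟨p⟩ ⟨q⟩
    exact f.app_comp p q

/-- Two surjective morphisms with the same kernel have isomorphic targets. -/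
noncomputable def isoOfKerEq (f : Hom P Q) (g : Hom P T)
    (hf : ∀ (A : Type) [Finite A], Function.Surjective (f.app A))
    (hg : ∀ (A : Type) [Finite A], Function.Surjective (g.app A))
    (h : ∀ (A : Type) [Finite A], LinearMap.ker (f.app A) = LinearMap.ker (g.app A)) :
    Iso Q T :=
  let E : ∀ (A : Type) [Finite A], Q.obj A ≃ₗ[k] T.obj A := fun A _ =>
    ((f.app A).quotKerEquivOfSurjective (hf A)).symm ≪≫ₗ Submodule.quotEquivOfEq _ _ (h A) ≪≫ₗ
      (g.app A).quotKerEquivOfSurjective (hg A)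
  have hE : ∀ (A : Type) [Finite A] (p : P.obj A), E A (f.app A p) = g.app A p := by
    intro A _ p
    have h1 : ((f.app A).quotKerEquivOfSurjective (hf A)).symm (f.app A p)
        = Submodule.Quotient.mk p := by
      rw [LinearEquiv.symm_apply_eq]
      rfl
    simp only [E, LinearEquiv.trans_apply, h1]
    rfl
  { equiv := E
    equiv_map := by
      intro A B _ _ e p
      obtain ⟨p, rfl⟩ := hf A p
      rw [← f.app_map, hE, hE, g.app_map]
    equiv_one := by rw [← f.app_one, hE, g.app_one]
    equiv_comp := by
      intro A B _ _ p q
      obtain ⟨p, rfl⟩ := hf _ p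
      obtain ⟨q, rfl⟩ := hf _ q
      rw [← f.app_comp, hE, hE, hE, g.app_comp] }

end Hom

theorem idealSpan_le {P : SymmOperad.{u, v} k} {n : ℕ} {S : Set (P.obj (Fin n))}
    {I : OperadIdeal P} (h : S ⊆ I.carrier (Fin n)) (A : Type) [Finite A] :
    (P.idealSpan S).carrier A ≤ I.carrier A :=
  iInf₂_le I h

theorem subset_idealSpan {P : SymmOperad.{u, v} k} {n : ℕ} (S : Set (P.obj (Fin n))) :
    S ⊆ (P.idealSpan S).carrier (Fin n) := by
  intro p hp
  simp only [idealSpan, SetLike.mem_coe, Submodule.mem_iInf]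
  exact fun I hI => hI hp

end SymmOperad

open SymmOperad

/-! ### Multilinear monomials and their decomposition -/

namespace OpTree

variable {Op X Y A B : Type}

theorem leaves_ne_nil (t : OpTree Op X) : t.leaves ≠ [] := by
  induction t with
  | leaf x => simp [leaves]
  | node o l r hl hr => simp [leaves, hl]

/-- A monomial can be written in any subset of the variables that contains its leaves. -/
theorem exists_rename_val (S : Set X) (t : OpTree Op X) (h : ∀ x ∈ t.leaves, x ∈ S) :
    ∃ s : OpTree Op S, s.rename Subtype.val = t := by
  induction t with
  | leaf x => exact ⟨leaf ⟨x, h x (by simp [leaves])⟩, rfl⟩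
  | node o l r hl hr =>
    obtain ⟨l', rfl⟩ := hl fun x hx => h x (by simp [leaves, hx])
    obtain ⟨r', rfl⟩ := hr fun x hx => h x (by simp [leaves, hx])
    exact ⟨node o l' r', rfl⟩

/-- A monomial without repeated variables is multilinear in the variables that occur in it. -/
theorem exists_multilinear (t : OpTree Op X) (h : t.leaves.Nodup) :
    ∃ s : OpTree Op {x // x ∈ t.leaves}, s.IsMultilinear ∧ s.rename Subtype.val = t := by
  obtain ⟨s, hs⟩ := exists_rename_val {x | x ∈ t.leaves} t fun x hx => hx
  have hl : s.leaves.map Subtype.val = t.leaves := by rw [← leaves_rename, hs]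
  refine ⟨s, ⟨List.Nodup.of_map Subtype.val (hl.symm ▸ h), fun a => ?_⟩, hs⟩
  have ha : a.1 ∈ s.leaves.map Subtype.val := hl.symm ▸ a.2
  obtain ⟨b, hb, hba⟩ := List.mem_map.1 ha
  exact Subtype.ext hba ▸ hb

theorem IsMultilinear.node_sum {s : OpTree Op A} {t : OpTree Op B} (hs : s.IsMultilinear)
    (ht : t.IsMultilinear) (o : Op) :
    (node o (s.rename Sum.inl) (t.rename Sum.inr)).IsMultilinear := by
  refine ⟨?_, ?_⟩
  · simp only [leaves, leaves_rename]
    refine (hs.1.map Sum.inl_injective).append (ht.1.map Sum.inr_injective) ?_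
    rw [List.disjoint_left]
    simp
  · rintro (a | b)
    · simp [leaves, leaves_rename, hs.2 a]
    · simp [leaves, leaves_rename, ht.2 b]

theorem rename_rename (f : X → Y) {Z : Type} (g : Y → Z) (t : OpTree Op X) :
    (t.rename f).rename g = t.rename (g ∘ f) :=
  bind_bind _ _ _

end OpTree

/-- Every multilinear monomial is obtained from the variable by relabellings and products. -/
theorem OpTree.IsMultilinear.induction {Op : Type}
    {P : ∀ (A : Type) [Finite A] (t : OpTree Op A), t.IsMultilinear → Prop}
    (one : P Unit (.leaf ()) OpTree.isMultilinear_leaf)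
    (rename : ∀ {A B : Type} [Finite A] [Finite B] (e : A ≃ B) (t : OpTree Op A)
      (h : t.IsMultilinear), P A t h → P B (t.rename e) (h.rename e))
    (node : ∀ {A B : Type} [Finite A] [Finite B] (o : Op) (s : OpTree Op A) (t : OpTree Op B)
      (hs : s.IsMultilinear) (ht : t.IsMultilinear), P A s hs → P B t ht →
        P (A ⊕ B) (.node o (s.rename Sum.inl) (t.rename Sum.inr)) (hs.node_sum ht o))
    (A : Type) [Finite A] (t : OpTree Op A) (h : t.IsMultilinear) : P A t h := by
  -- The branches of a multilinear monomial are multilinear only over smaller variable sets, so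
  -- structural recursion on `t` with `A` fixed fails. The recursion runs on a tree `w` with
  -- arbitrary labels, and `s` is any multilinear monomial that renames to it.
  suffices H : ∀ {X : Type} (w : OpTree Op X) (A : Type) [Finite A] (f : A → X)
      (s : OpTree Op A) (hs : s.IsMultilinear), s.rename f = w → P A s hs from
    H _ A id t h rfl
  intro X w
  induction w with
  | leaf x =>
    intro A _ f s hs hw
    cases s with
    | node o l r => cases hw
    | leaf a =>
      have hall : ∀ b, b = a := fun b => by simpa [OpTree.leaves] using hs.2 b
      let e : Unit ≃ A := ⟨fun _ => a, fun _ => (), fun _ => rfl, fun b => (hall b).symm⟩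
      exact rename e _ _ one
  | node o l r hl hr =>
    intro A _ f s hs hw
    cases s with
    | leaf a => cases hw
    | node o' sl sr =>
      obtain ⟨hln, hrn, hd⟩ :=
        List.nodup_append'.1 (show (sl.leaves ++ sr.leaves).Nodup from hs.1)
      have hw' : OpTree.node o' (sl.rename f) (sr.rename f) = OpTree.node o l r := hw
      injection hw' with ho hl' hr'
      obtain ⟨sl', hsl, hsl'⟩ := sl.exists_multilinear hln
      obtain ⟨sr', hsr, hsr'⟩ := sr.exists_multilinear hrn
      have h1 := hl _ (f ∘ Subtype.val) sl' hsl (by rw [← OpTree.rename_rename, hsl', hl'])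
      have h2 := hr _ (f ∘ Subtype.val) sr' hsr (by rw [← OpTree.rename_rename, hsr', hr'])
      -- Multilinearity says that the variables are the disjoint union of those of the two branches.
      let e : {a // a ∈ sl.leaves} ⊕ {a // a ∈ sr.leaves} ≃ A :=
        Equiv.ofBijective (Sum.elim Subtype.val Subtype.val) (by
          refine ⟨?_, fun a => ?_⟩
          · refine Function.Injective.sumElim Subtype.val_injective Subtype.val_injective ?_
            rintro ⟨a, ha⟩ ⟨b, hb⟩ hab
            exact hd ha ((show a = b from hab) ▸ hb)
          · rcases List.mem_append.1 (hs.2 a) with h | h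
            · exact ⟨Sum.inl ⟨a, h⟩, rfl⟩
            · exact ⟨Sum.inr ⟨a, h⟩, rfl⟩)
      have h3 := rename e _ _ (node o' _ _ _ _ h1 h2)
      have h4 : (OpTree.node o' (sl'.rename Sum.inl) (sr'.rename Sum.inr)).rename e =
          OpTree.node o' sl sr := by
        change OpTree.node o' ((sl'.rename Sum.inl).rename e) ((sr'.rename Sum.inr).rename e) = _
        rw [OpTree.rename_rename, OpTree.rename_rename]
        exact congrArg₂ _ hsl' hsr'
      simpa only [h4] using h3

/-! ### Morphisms from free operads -/

section FreeOperad

variable {k : Type u} [Field k] {Op A B : Type} [Finite A] [Finite B]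

/-- A multilinear monomial as an element of the free operad. -/
noncomputable def freeTree (k : Type u) [Field k] (t : OpTree Op A) (h : t.IsMultilinear) :
    (freeOperad k Op).obj A :=
  (Finsupp.single ⟨t, h⟩ 1 : MultMonomial Op A →₀ k)

/-- The linear map on a component of the free operad with given values on monomials. -/
noncomputable def freeLift {M : Type*} [AddCommGroup M] [Module k M]
    (f : ∀ t : OpTree Op A, t.IsMultilinear → M) : (freeOperad k Op).obj A →ₗ[k] M :=
  Finsupp.linearCombination k fun t : MultMonomial Op A => f t.1 t.2

theorem freeLift_tree {M : Type*} [AddCommGroup M] [Module k M]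
    (f : ∀ t : OpTree Op A, t.IsMultilinear → M) (t : OpTree Op A) (h : t.IsMultilinear) :
    freeLift f (freeTree k t h) = f t h :=
  (Finsupp.linearCombination_single k 1 _).trans (one_smul k _)

theorem freeOperad_induction {P : (freeOperad k Op).obj A → Prop} (zero : P 0)
    (add : ∀ p q, P p → P q → P (p + q)) (smul : ∀ (c : k) p, P p → P (c • p))
    (tree : ∀ t h, P (freeTree k t h)) (p : (freeOperad k Op).obj A) : P p := by
  refine Finsupp.induction_linear (motive := P) p zero (fun p q => add p q) fun t c => ?_
  have hc : (Finsupp.single t c : MultMonomial Op A →₀ k) = c • Finsupp.single t 1 := by simp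
  rw [hc]
  exact smul c _ (tree t.1 t.2)

/-- Linear maps that agree on monomials are equal. -/
theorem freeOperad_linearMap_ext {M : Type*} [AddCommGroup M] [Module k M]
    {f g : (freeOperad k Op).obj A →ₗ[k] M}
    (h : ∀ t ht, f (freeTree k t ht) = g (freeTree k t ht)) : f = g := by
  refine LinearMap.ext fun p => ?_
  induction p using freeOperad_induction with
  | zero => rw [map_zero, map_zero]
  | add p q hp hq => rw [map_add, map_add, hp, hq]
  | smul c p hp => rw [map_smul, map_smul, hp]
  | tree t ht => exact h t ht

theorem freeOperad_map_tree (e : A ≃ B) (t : OpTree Op A) (h : t.IsMultilinear) :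
    (freeOperad k Op).map e (freeTree k t h) = freeTree k (t.rename e) (h.rename e) :=
  freeMap_single e _ 1

theorem freeOperad_comp_tree (t : OpTree Op (Option A)) (s : OpTree Op B) (ht : t.IsMultilinear)
    (hs : s.IsMultilinear) :
    (freeOperad k Op).comp (freeTree k t ht) (freeTree k s hs) =
      freeTree k (t.graft s) (ht.graft hs) :=
  (freeComp_single _ _ 1 1).trans (by rw [mul_one]; rfl)

theorem freeOperad_one :
    (freeOperad k Op).one = freeTree k (.leaf ()) OpTree.isMultilinear_leaf :=
  rfl

theorem mono_eq_freeTree {n : ℕ} (t : OpTree Op (Fin n)) (h : t.IsMultilinear) :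
    mono k t h = freeTree k t h :=
  rfl

theorem OpTree.isMultilinear_gen (o : Op) :
    (node o (leaf 0) (leaf 1) : OpTree Op (Fin 2)).IsMultilinear := by
  simp [IsMultilinear, leaves]

/-- The operation `x₁ o x₂` of a free operad. -/
noncomputable def freeGen (k : Type u) [Field k] (o : Op) : (freeOperad k Op).obj (Fin 2) :=
  freeTree k (.node o (.leaf 0) (.leaf 1)) (OpTree.isMultilinear_gen o)

/-- The two inputs of a binary operation, the second one being the input for compositions. -/
def finTwoOptionEquiv : Fin 2 ≃ Option Unit where
  toFun := ![some (), none]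
  invFun := fun | some _ => 0 | none => 1
  left_inv := by decide
  right_inv := by rintro (_ | _) <;> rfl

/-- Insert `t` into the second input of the generator, make the remaining input the distinguished
one, insert `s` there, and restore the order of the summands. This shows that generators determine a
morphism: every product is an operadic composition. -/
theorem freeTree_node_sum (o : Op) (s : OpTree Op A) (t : OpTree Op B) (hs : s.IsMultilinear)
    (ht : t.IsMultilinear) :
    freeTree k (.node o (s.rename Sum.inl) (t.rename Sum.inr)) (hs.node_sum ht o) =
      (freeOperad k Op).map (Equiv.sumComm B A)
        ((freeOperad k Op).comp
          ((freeOperad k Op).map ((Equiv.sumComm Unit B).trans (sumUnitEquiv B))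
            ((freeOperad k Op).comp
              ((freeOperad k Op).map finTwoOptionEquiv (freeGen k o)) (freeTree k t ht)))
          (freeTree k s hs)) := by
  rw [freeGen, freeOperad_map_tree, freeOperad_comp_tree, freeOperad_map_tree,
    freeOperad_comp_tree, freeOperad_map_tree]
  congr 1
  have h0 : finTwoOptionEquiv 0 = some () := rfl
  have h1 : finTwoOptionEquiv 1 = none := rfl
  have h2 : ((Equiv.sumComm Unit B).trans (sumUnitEquiv B)) (Sum.inl ()) = none := rfl
  simp only [OpTree.rename, OpTree.graft, OpTree.bind, h0, h1, h2, OpTree.bind_bind]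
  rfl

/-- Two morphisms from a free operad that agree on the generators are equal. -/
theorem freeOperad_hom_ext {Q : SymmOperad.{u, w} k}
    (f g : Hom (freeOperad k Op) Q)
    (h : ∀ o, f.app (Fin 2) (freeGen k o) = g.app (Fin 2) (freeGen k o))
    (A : Type) [Finite A] : f.app A = g.app A := by
  refine freeOperad_linearMap_ext ?_
  refine OpTree.IsMultilinear.induction (P := fun A _ t ht =>
    f.app A (freeTree k t ht) = g.app A (freeTree k t ht)) ?_ ?_ ?_ A
  · exact f.app_one.trans g.app_one.symm
  · intro A B _ _ e t _ ht
    rw [← freeOperad_map_tree, f.app_map, g.app_map, ht]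
  · intro A B _ _ o s t _ _ hs ht
    rw [freeTree_node_sum]
    rw [f.app_map, f.app_comp, f.app_map, f.app_comp, f.app_map, g.app_map, g.app_comp,
      g.app_map, g.app_comp, g.app_map, h, hs, ht]

end FreeOperad

/-- The morphism of free operads induced by a map of monomials that is compatible with
substitutions. -/
noncomputable def freeHom (k : Type u) [Field k] {Op Op' : Type}
    (f : ∀ {X : Type}, OpTree Op X → OpTree Op' X)
    (hml : ∀ {A : Type} (t : OpTree Op A), t.IsMultilinear → (f t).IsMultilinear)
    (hleaf : ∀ {X : Type} (x : X), f (.leaf x) = .leaf x)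
    (hbind : ∀ {X Y : Type} (t : OpTree Op X) (g : X → OpTree Op Y),
      f (t.bind g) = (f t).bind fun x => f (g x)) :
    Hom (freeOperad k Op) (freeOperad k Op') where
  app A _ := freeLift fun t h => freeTree k (f t) (hml t h)
  app_map := by
    intro A B _ _ e p
    induction p using freeOperad_induction with
    | zero => simp only [map_zero]
    | add p q hp hq => simp only [map_add, hp, hq]
    | smul c p hp => simp only [map_smul, hp]
    | tree t h => simp only [freeOperad_map_tree, freeLift_tree, OpTree.rename, hbind, hleaf]
  app_one := by simp only [freeOperad_one, freeLift_tree, hleaf]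
  app_comp := by
    intro A B _ _ p q
    induction p using freeOperad_induction with
    | zero => simp only [map_zero, LinearMap.zero_apply]
    | add p p' hp hp' => simp only [map_add, LinearMap.add_apply, hp, hp']
    | smul c p hp => simp only [map_smul, LinearMap.smul_apply, hp]
    | tree t _ =>
      induction q using freeOperad_induction with
      | zero => simp only [map_zero]
      | add q q' hq hq' => simp only [map_add, hq, hq']
      | smul c q hq => simp only [map_smul, hq]
      | tree s _ =>
        simp only [freeOperad_comp_tree, freeLift_tree]
        congr 1
        simp only [OpTree.graft, hbind]
        congr 1
        funext x
        rcases x with _ | a <;> simp [OpTree.rename, hbind, hleaf]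

/-! ### Second factors and change of operations in monomials -/

namespace OpTree

/-- Exchanging branches at a vertex commutes with substitution at the leaves; this is what makes the
second factor a morphism of operads. -/
theorem sndFactor_bind {Op₁ Op₂ X Y : Type} (t : OpTree (Op₁ × Op₂ × Bool) X)
    (g : X → OpTree (Op₁ × Op₂ × Bool) Y) :
    (t.bind g).sndFactor = t.sndFactor.bind fun x => (g x).sndFactor := by
  induction t with
  | leaf x => rfl
  | node o l r hl hr => obtain ⟨o₁, o₂, _ | _⟩ := o <;> simp [bind, sndFactor, hl, hr]

/-- The monomial obtained by replacing each operation `o` by `φ o`. -/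
def mapOp {Op Op' X : Type} (φ : Op → Op') : OpTree Op X → OpTree Op' X
  | leaf x => leaf x
  | node o l r => node (φ o) (l.mapOp φ) (r.mapOp φ)

variable {Op Op' X Y A : Type} (φ : Op → Op')

theorem leaves_mapOp (t : OpTree Op X) : (t.mapOp φ).leaves = t.leaves := by
  induction t with
  | leaf x => rfl
  | node o l r hl hr => simp [mapOp, leaves, hl, hr]

theorem IsMultilinear.mapOp {t : OpTree Op A} (ht : t.IsMultilinear) :
    (t.mapOp φ).IsMultilinear := by
  simpa [IsMultilinear, leaves_mapOp] using ht

theorem mapOp_bind (t : OpTree Op X) (g : X → OpTree Op Y) :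
    (t.bind g).mapOp φ = (t.mapOp φ).bind fun x => (g x).mapOp φ := by
  induction t with
  | leaf x => rfl
  | node o l r hl hr => simp [bind, OpTree.mapOp, hl, hr]

end OpTree

/-- The morphism of free operads that takes the second tensor factor of monomials. -/
noncomputable def sndHom (k : Type u) [Field k] (Op₁ Op₂ : Type) :
    Hom (freeOperad k (Op₁ × Op₂ × Bool)) (freeOperad k Op₂) :=
  freeHom k OpTree.sndFactor (fun _ h => h.sndFactor) (fun _ => rfl) OpTree.sndFactor_bind

/-- The morphism of free operads that replaces each generator `o` by the generator `φ o`. -/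
noncomputable def mapOpHom (k : Type u) [Field k] {Op Op' : Type} (φ : Op → Op') :
    Hom (freeOperad k Op) (freeOperad k Op') :=
  freeHom k (OpTree.mapOp φ) (fun _ h => h.mapOp φ) (fun _ => rfl) (OpTree.mapOp_bind φ)

theorem sndHom_tree {k : Type u} [Field k] {Op₁ Op₂ A : Type} [Finite A]
    (t : OpTree (Op₁ × Op₂ × Bool) A) (h : t.IsMultilinear) :
    (sndHom k Op₁ Op₂).app A (freeTree k t h) = freeTree k t.sndFactor h.sndFactor :=
  freeLift_tree (fun t h => freeTree k t.sndFactor (OpTree.IsMultilinear.sndFactor h)) t h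

theorem mapOpHom_tree {k : Type u} [Field k] {Op Op' A : Type} [Finite A] (φ : Op → Op')
    (t : OpTree Op A) (h : t.IsMultilinear) :
    (mapOpHom k φ).app A (freeTree k t h) = freeTree k (t.mapOp φ) (h.mapOp φ) :=
  freeLift_tree (fun t h => freeTree k (t.mapOp φ) (OpTree.IsMultilinear.mapOp φ h)) t h

/-! ### Associative monomials -/

/-- The image of a polynomial in the free associative algebra. -/
noncomputable def wordMap (k : Type u) [Field k] (Op A : Type) [Finite A] :
    (freeOperad k Op).obj A →ₗ[k] (List A →₀ k) :=
  freeLift fun t _ => Finsupp.single t.leaves 1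

theorem wordMap_tree {k : Type u} [Field k] {Op A : Type} [Finite A] (t : OpTree Op A)
    (h : t.IsMultilinear) : wordMap k Op A (freeTree k t h) = Finsupp.single t.leaves 1 :=
  freeLift_tree _ t h

/-- Insertion of a word for the variable `none` of a word. -/
def graftWord {A B : Type} (l : List (Option A)) (m : List B) : List (A ⊕ B) :=
  l.flatMap fun
    | none => m.map Sum.inr
    | some a => [Sum.inl a]

theorem OpTree.leaves_graft {Op A B : Type} (t : OpTree Op (Option A)) (s : OpTree Op B) :
    (t.graft s).leaves = graftWord t.leaves s.leaves := by
  rw [OpTree.graft, OpTree.leaves_bind, graftWord]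
  congr 1
  funext x
  rcases x with _ | a <;> simp [OpTree.leaves_rename, OpTree.leaves]

/-- The operadic ideal of the polynomials whose image in the free associative algebra vanishes. -/
noncomputable def wordIdeal (k : Type u) [Field k] (Op : Type) : OperadIdeal (freeOperad k Op) where
  carrier A _ := LinearMap.ker (wordMap k Op A)
  map_mem := by
    intro A B _ _ e p hp
    have h : wordMap k Op B ∘ₗ (freeOperad k Op).map e =
        Finsupp.lmapDomain k k (List.map e) ∘ₗ wordMap k Op A := by
      refine freeOperad_linearMap_ext fun t ht => ?_
      simp [freeOperad_map_tree, wordMap_tree, OpTree.leaves_rename]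
    rw [LinearMap.mem_ker] at hp ⊢
    simpa [hp] using LinearMap.congr_fun h p
  comp_mem_left := by
    intro A B _ _ p q hp
    rw [LinearMap.mem_ker] at hp ⊢
    induction q using freeOperad_induction with
    | zero => simp only [map_zero]
    | add q q' hq hq' => simp only [map_add, hq, hq', add_zero]
    | smul c q hq => simp only [map_smul, hq, smul_zero]
    | tree s hs =>
      have h : wordMap k Op (A ⊕ B) ∘ₗ (freeOperad k Op).comp.flip (freeTree k s hs) =
          Finsupp.lmapDomain k k (fun l => graftWord l s.leaves) ∘ₗ wordMap k Op (Option A) := by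
        refine freeOperad_linearMap_ext fun t ht => ?_
        simp [freeOperad_comp_tree, wordMap_tree, OpTree.leaves_graft]
      simpa [hp] using LinearMap.congr_fun h p
  comp_mem_right := by
    intro A B _ _ p q hq
    rw [LinearMap.mem_ker] at hq ⊢
    induction p using freeOperad_induction with
    | zero => simp only [map_zero, LinearMap.zero_apply]
    | add p p' hp hp' => simp only [map_add, LinearMap.add_apply, hp, hp', add_zero]
    | smul c p hp => simp only [map_smul, LinearMap.smul_apply, hp, smul_zero]
    | tree t ht =>
      have h : wordMap k Op (A ⊕ B) ∘ₗ (freeOperad k Op).comp (freeTree k t ht) =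
          Finsupp.lmapDomain k k (graftWord t.leaves) ∘ₗ wordMap k Op B := by
        refine freeOperad_linearMap_ext fun t ht => ?_
        simp [freeOperad_comp_tree, wordMap_tree, OpTree.leaves_graft]
      simpa [hq] using LinearMap.congr_fun h q

theorem asRelations_subset_wordIdeal (k : Type u) [Field k] :
    asRelations k ⊆ (wordIdeal k Unit).carrier (Fin 3) := by
  rintro _ rfl
  refine LinearMap.mem_ker.2 ?_
  simp [leftMono, rightMono, mono_eq_freeTree, wordMap_tree, OpTree.leaves]

/-- The coefficient of the word `l` of elements of `As(3)`. -/
noncomputable def wordCoeff (k : Type u) [Field k] (l : List (Fin 3)) :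
    (quadraticOperad k (asRelations k)).obj (Fin 3) →ₗ[k] k :=
  Submodule.liftQ _ (Finsupp.lapply l ∘ₗ wordMap k Unit (Fin 3)) <|
    (idealSpan_le (asRelations_subset_wordIdeal k) (Fin 3)).trans (LinearMap.ker_le_ker_comp _ _)

theorem wordCoeff_mk (k : Type u) [Field k] (l : List (Fin 3))
    (p : (freeOperad k Unit).obj (Fin 3)) :
    wordCoeff k l (quadraticOperad.mk (asRelations k) p) = wordMap k Unit (Fin 3) p l :=
  rfl

/-! ### The relations of a white product `As ∘ Var` -/

section White

variable {k : Type u} [Field k] (R : Set ((freeOperad k Unit).obj (Fin 3)))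

theorem whiteMap_tree {Op₁ Op₂ : Type} (R₁ : Set ((freeOperad k Op₁).obj (Fin 3)))
    (R₂ : Set ((freeOperad k Op₂).obj (Fin 3))) (t : OpTree (Op₁ × Op₂ × Bool) (Fin 3))
    (ht : t.IsMultilinear) :
    whiteMap k R₁ R₂ (freeTree k t ht) =
      quadraticOperad.mk R₁ (freeTree k t.fstFactor ht.fstFactor) ⊗ₜ[k]
        quadraticOperad.mk R₂ (freeTree k t.sndFactor ht.sndFactor) :=
  (Finsupp.linearCombination_single k 1 _).trans (one_smul k _)

/-- The part of a polynomial that consists of the monomials with leaves `l`. -/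
noncomputable def wordPart (k : Type u) [Field k] {Op A : Type} [Finite A] [DecidableEq A]
    (l : List A) : (freeOperad k Op).obj A →ₗ[k] (freeOperad k Op).obj A :=
  freeLift fun t ht => if t.leaves = l then freeTree k t ht else 0

/-- A linear map that vanishes on all parts of a polynomial vanishes on it. -/
theorem eq_zero_of_wordPart {Op A : Type} {M : Type*} [Finite A] [DecidableEq A] [AddCommGroup M]
    [Module k M] (f : (freeOperad k Op).obj A →ₗ[k] M) (p : (freeOperad k Op).obj A)
    (h : ∀ l, f (wordPart k l p) = 0) : f p = 0 := by
  classical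
  -- There are infinitely many words, so the decomposition uses a finite set. Allowing every larger
  -- finite set lets two decompositions be added over the union.
  have key : ∃ s : Finset (List A), ∀ s', s ⊆ s' → p = ∑ l ∈ s', wordPart k l p := by
    clear h
    induction p using freeOperad_induction with
    | zero => exact ⟨∅, fun s' _ => by simp⟩
    | add p q hp hq =>
      obtain ⟨s, hs⟩ := hp
      obtain ⟨t, ht⟩ := hq
      refine ⟨s ∪ t, fun s' h => ?_⟩
      simp only [map_add, Finset.sum_add_distrib]
      rw [← hs s' (Finset.union_subset_left h), ← ht s' (Finset.union_subset_right h)]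
    | smul c p hp =>
      obtain ⟨s, hs⟩ := hp
      refine ⟨s, fun s' h => ?_⟩
      simp only [map_smul, ← Finset.smul_sum]
      rw [← hs s' h]
    | tree t ht =>
      refine ⟨{t.leaves}, fun s' h => ?_⟩
      simp only [wordPart, freeLift_tree]
      rw [Finset.sum_ite_eq, if_pos (h (Finset.mem_singleton_self _))]
  obtain ⟨s, hs⟩ := key
  rw [hs s subset_rfl, map_sum]
  exact Finset.sum_eq_zero fun l _ => h l

/-- The relations of `As ∘ Var` are the polynomials whose homogeneous parts, with respect to the
order of the variables, become relations of `Var` when `x₁ ≻ x₂` is read as `x₂ x₁`. -/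
theorem mk_sndHom_wordPart {p : (freeOperad k (Unit × Unit × Bool)).obj (Fin 3)}
    (hp : p ∈ whiteRelations k (asRelations k) R) (l : List (Fin 3)) :
    quadraticOperad.mk R ((sndHom k Unit Unit).app (Fin 3) (wordPart k l p)) = 0 := by
  -- The coefficient of the word `l` applied to the `As` factor annihilates the other words and
  -- leaves the `Var` factor of the part with order `l`.
  let F := (TensorProduct.lid k _).toLinearMap ∘ₗ
    (wordCoeff k l).rTensor ((quadraticOperad k R).obj (Fin 3))
  have h : F ∘ₗ whiteMap k (asRelations k) R =
      quadraticOperad.mk R ∘ₗ (sndHom k Unit Unit).app (Fin 3) ∘ₗ wordPart k l := by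
    refine freeOperad_linearMap_ext fun t ht => ?_
    simp only [F, LinearMap.comp_apply, whiteMap_tree, LinearMap.rTensor_tmul,
      LinearEquiv.coe_coe, TensorProduct.lid_tmul, wordCoeff_mk, wordMap_tree,
      OpTree.leaves_fstFactor, wordPart, freeLift_tree, Finsupp.single_apply]
    split_ifs <;> simp [sndHom_tree]
  have hp' : whiteMap k (asRelations k) R p = 0 := hp
  simpa [hp'] using (LinearMap.congr_fun h p).symm

end White

/-! ### The quotient of `As ∘ Var` that defines the nonsymmetric version -/

section NonsymmetricVersion

variable {k : Type u} [Field k] (R : Set ((freeOperad k Unit).obj (Fin 3)))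

/-- The operad `(As ∘ Var) / {g₁ - h₂ = 0, g₂ - h₁ = 0}`. -/
noncomputable def identifiedProduct : SymmOperad.{u, u} k :=
  (whiteProduct k (asRelations k) R).quotient
    ((whiteProduct k (asRelations k) R).idealSpan (identification k R))

/-- The projection from the free operad with two generators. -/
noncomputable def identifiedProj :
    Hom (freeOperad k (Unit × Unit × Bool)) (identifiedProduct R) :=
  Hom.trans (Q := whiteProduct k (asRelations k) R)
    (Hom.quotientMk ((freeOperad k (Unit × Unit × Bool)).idealSpan
      (whiteRelations k (asRelations k) R)))
    (Hom.quotientMk ((whiteProduct k (asRelations k) R).idealSpan (identification k R)))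

theorem identifiedProj_surjective (A : Type) [Finite A] :
    Function.Surjective ((identifiedProj R).app A) :=
  (Hom.quotientMk_surjective ((whiteProduct k (asRelations k) R).idealSpan
    (identification k R)) A).comp
    (Hom.quotientMk_surjective ((freeOperad k (Unit × Unit × Bool)).idealSpan
      (whiteRelations k (asRelations k) R)) A)

theorem identifiedProj_whiteRelations {p : (freeOperad k (Unit × Unit × Bool)).obj (Fin 3)}
    (hp : p ∈ whiteRelations k (asRelations k) R) : (identifiedProj R).app (Fin 3) p = 0 := by
  have h := (Hom.quotientMk_eq_zero_iff ((freeOperad k (Unit × Unit × Bool)).idealSpan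
    (whiteRelations k (asRelations k) R)) p).2 (subset_idealSpan _ hp)
  exact (congrArg ((Hom.quotientMk ((whiteProduct k (asRelations k) R).idealSpan
    (identification k R))).app (Fin 3)) h).trans (map_zero _)

theorem OpTree.isMultilinear_gen_swap {Op : Type} (o : Op) :
    (node o (leaf 1) (leaf 0) : OpTree Op (Fin 2)).IsMultilinear := by
  simp [IsMultilinear, leaves]

/-- This is the relation `g₁ - h₂`; the other one, `g₂ - h₁`, is its image under the transposition.
-/
theorem identifiedProj_gen :
    (identifiedProj R).app (Fin 2) (freeGen k ((), (), true)) =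
      (identifiedProj R).app (Fin 2)
        (freeTree k (.node ((), (), false) (.leaf 1) (.leaf 0))
          (OpTree.isMultilinear_gen_swap _)) := by
  have h := (Hom.quotientMk_eq_zero_iff ((whiteProduct k (asRelations k) R).idealSpan
    (identification k R)) _).2 (subset_idealSpan _ (Or.inl rfl))
  exact sub_eq_zero.1 ((map_sub _ _ _).symm.trans h)

/-- Reading `x₁ ≻ x₂` as `x₂ ≺ x₁` does not change the image in the quotient. -/
theorem identifiedProj_mapOp_snd (A : Type) [Finite A]
    (p : (freeOperad k (Unit × Unit × Bool)).obj A) :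
    (identifiedProj R).app A ((mapOpHom k fun _ => ((), (), false)).app A
      ((sndHom k Unit Unit).app A p)) = (identifiedProj R).app A p := by
  -- Both sides are morphisms from the free operad, so only the generators matter: `≺` is unchanged
  -- and `≻` is handled by the imposed identification.
  refine LinearMap.congr_fun (freeOperad_hom_ext
    (((sndHom k Unit Unit).trans (mapOpHom k fun _ => ((), (), false))).trans (identifiedProj R))
    (identifiedProj R) ?_ A) p
  rintro ⟨⟨⟩, ⟨⟩, _ | _⟩
  · change (identifiedProj R).app _ ((mapOpHom k _).app _ ((sndHom k Unit Unit).app _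
      (freeTree k _ _))) = _
    rw [sndHom_tree, mapOpHom_tree]
    rfl
  · rw [identifiedProj_gen]
    change (identifiedProj R).app _ ((mapOpHom k _).app _ ((sndHom k Unit Unit).app _
      (freeTree k _ _))) = _
    rw [sndHom_tree, mapOpHom_tree]
    rfl

/-- A morphism from the free operad with one generator induces a morphism from the quotient if it
kills the relations of `As ∘ Var` after `x₁ ≻ x₂` is read as `x₂ x₁`. -/
theorem exists_hom_identifiedProduct {T : SymmOperad.{u, w} k} (g : Hom (freeOperad k Unit) T)
    (hg : ∀ p ∈ whiteRelations k (asRelations k) R,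
      g.app (Fin 3) ((sndHom k Unit Unit).app (Fin 3) p) = 0) :
    ∃ h : Hom (identifiedProduct R) T, ∀ (A : Type) [Finite A]
      (p : (freeOperad k (Unit × Unit × Bool)).obj A),
      h.app A ((identifiedProj R).app A p) = g.app A ((sndHom k Unit Unit).app A p) := by
  let f := (sndHom k Unit Unit).trans g
  let f₁ : Hom (whiteProduct k (asRelations k) R) T := f.lift _ (idealSpan_le fun p hp =>
    LinearMap.mem_ker.2 (hg p hp))
  have hf₁ : ∀ (A : Type) [Finite A] (p : (freeOperad k (Unit × Unit × Bool)).obj A),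
      f₁.app A ((Hom.quotientMk ((freeOperad k (Unit × Unit × Bool)).idealSpan
        (whiteRelations k (asRelations k) R))).app A p) = f.app A p := fun A _ p => rfl
  -- The morphism depends on the second factor only, and both identifying relations are differences
  -- of two operations with equal second factors.
  have key : ∀ (b c : Bool) (i j i' j' : Fin 2) h h',
      (OpTree.node ((), (), b) (.leaf i) (.leaf j)).sndFactor =
        (OpTree.node ((), (), c) (.leaf i') (.leaf j')).sndFactor →
      f₁.app (Fin 2) (asOp k R b i j h - asOp k R c i' j' h') = 0 := by
    intro b c i j i' j' h h' e
    rw [map_sub, sub_eq_zero]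
    refine (hf₁ (Fin 2) (freeTree k _ h)).trans (Eq.trans ?_ (hf₁ (Fin 2) (freeTree k _ h')).symm)
    change g.app _ ((sndHom k Unit Unit).app _ _) = g.app _ ((sndHom k Unit Unit).app _ _)
    simp only [sndHom_tree, e]
  refine ⟨f₁.lift _ (idealSpan_le ?_), fun A _ p => rfl⟩
  rintro _ (rfl | rfl)
  · exact LinearMap.mem_ker.2 (key _ _ _ _ _ _ _ _ rfl)
  · exact LinearMap.mem_ker.2 (key _ _ _ _ _ _ _ _ rfl)

/-- The operation `≺` involves no exchange of branches. Writing every product as `≺` is thus a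
section of the second factor, which makes the latter surjective. -/
theorem sndHom_mapOpHom (A : Type) [Finite A] (p : (freeOperad k Unit).obj A) :
    (sndHom k Unit Unit).app A ((mapOpHom k fun _ => ((), (), false)).app A p) = p := by
  have ht : ∀ t : OpTree Unit A, (t.mapOp fun _ => ((), (), false)).sndFactor = t := by
    intro t
    induction t with
    | leaf x => rfl
    | node o l r hl hr => exact congrArg₂ _ hl hr
  induction p using freeOperad_induction with
  | zero => simp only [map_zero]
  | add p q hp hq => simp only [map_add, hp, hq]
  | smul c p hp => simp only [map_smul, hp]
  | tree t h => simp only [mapOpHom_tree, sndHom_tree, ht]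

theorem s3Span_le_idealSpan {Op : Type} (S : Set ((freeOperad k Op).obj (Fin 3)))
    (I : OperadIdeal (freeOperad k Op)) (h : S ⊆ I.carrier (Fin 3)) :
    s3Span k S ≤ I.carrier (Fin 3) := by
  refine Submodule.span_le.2 (Set.iUnion_subset fun e => ?_)
  rintro _ ⟨p, hp, rfl⟩
  exact I.map_mem e p (h hp)

theorem subset_s3Span {Op : Type} (S : Set ((freeOperad k Op).obj (Fin 3))) :
    S ⊆ s3Span k S := fun p hp =>
  Submodule.subset_span (Set.mem_iUnion.2 ⟨Equiv.refl _, p, hp, (freeOperad k Op).map_refl p⟩)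

/-- `Var` admits a nonsymmetric version if its relations, written with `≺` only, hold in the
quotient of `As ∘ Var`. -/
theorem admitsNonsymmetricVersion_of_proj
    (h : ∀ r ∈ R, (identifiedProj R).app (Fin 3)
      ((mapOpHom k fun _ => ((), (), false)).app (Fin 3) r) = 0) :
    AdmitsNonsymmetricVersion k R := by
  let g := Hom.quotientMk ((freeOperad k Unit).idealSpan R)
  -- Both operads are quotients of the free operad on `≺` and `≻`, so it suffices to compare the two
  -- kernels.
  refine ⟨Hom.isoOfKerEq (identifiedProj R) ((sndHom k Unit Unit).trans g)
    (identifiedProj_surjective R) (fun A _ => ?_) (fun A _ => le_antisymm ?_ ?_)⟩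
  · intro q
    obtain ⟨p, rfl⟩ := Hom.quotientMk_surjective _ A q
    exact ⟨_, congrArg (g.app A) (sndHom_mapOpHom A p)⟩
  -- The projection to `Var` factors through the identified product: every word part of a white
  -- relation reads as a relation of `Var`, hence so does their sum.
  · obtain ⟨f, hf⟩ := exists_hom_identifiedProduct R g fun p hp =>
      eq_zero_of_wordPart (g.app (Fin 3) ∘ₗ (sndHom k Unit Unit).app (Fin 3)) p
        (mk_sndHom_wordPart R hp)
    intro p hp
    rw [LinearMap.mem_ker] at hp ⊢
    exact (hf A p).symm.trans ((congrArg (f.app A) hp).trans (map_zero _))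
  -- If the reading of `p` lies in the ideal of `Var`, then rewriting it with `≺` gives zero by
  -- hypothesis, and that rewriting has the same image as `p`.
  · intro p hp
    rw [LinearMap.mem_ker] at hp ⊢
    have h1 : (sndHom k Unit Unit).app A p ∈ ((freeOperad k Unit).idealSpan R).carrier A :=
      (Hom.quotientMk_eq_zero_iff _ _).1 hp
    have h2 := idealSpan_le (I := ((mapOpHom k fun _ => ((), (), false)).trans
      (identifiedProj R)).ker) (fun r hr => LinearMap.mem_ker.2 (h r hr)) A h1
    exact (identifiedProj_mapOp_snd R A p).symm.trans (LinearMap.mem_ker.1 h2)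

/-- `Var` admits a nonsymmetric version if its relations are generated by elements that come from
relations of `As ∘ Var`. -/
theorem admitsNonsymmetricVersion_of_s3Span {S : Set ((freeOperad k Unit).obj (Fin 3))}
    (hS : s3Span k S = s3Span k R)
    (h : ∀ r ∈ S, ∃ p ∈ whiteRelations k (asRelations k) R,
      (sndHom k Unit Unit).app (Fin 3) p = r) : AdmitsNonsymmetricVersion k R := by
  refine admitsNonsymmetricVersion_of_proj R fun r hr => ?_
  have h1 : r ∈ s3Span k S := hS ▸ subset_s3Span R hr
  refine LinearMap.mem_ker.1 (s3Span_le_idealSpan S ((mapOpHom k fun _ => ((), (), false)).trans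
      (identifiedProj R)).ker (fun q hq => LinearMap.mem_ker.2 ?_) h1)
  obtain ⟨p, hp, rfl⟩ := h q hq
  exact (identifiedProj_mapOp_snd R _ p).trans (identifiedProj_whiteRelations R hp)

end NonsymmetricVersion

/-! ### The Novikov operad -/

section Novikov

variable (k : Type u) [Field k]

theorem map_leftMono (e : Equiv.Perm (Fin 3)) (a b c : Fin 3) (h) :
    (freeOperad k Unit).map e (leftMono k a b c h) = leftMono k (e a) (e b) (e c) (h.rename e) :=
  freeOperad_map_tree e _ h

theorem map_rightMono (e : Equiv.Perm (Fin 3)) (a b c : Fin 3) (h) :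
    (freeOperad k Unit).map e (rightMono k a b c h) = rightMono k (e a) (e b) (e c) (h.rename e) :=
  freeOperad_map_tree e _ h

theorem map_mem_s3Span {S : Set ((freeOperad k Unit).obj (Fin 3))}
    {p : (freeOperad k Unit).obj (Fin 3)} (hp : p ∈ S) (e : Equiv.Perm (Fin 3)) :
    (freeOperad k Unit).map e p ∈ s3Span k S :=
  Submodule.subset_span (Set.mem_iUnion.2 ⟨e, p, hp, rfl⟩)

theorem map_s3Span_mem {S : Set ((freeOperad k Unit).obj (Fin 3))}
    {p : (freeOperad k Unit).obj (Fin 3)} (hp : p ∈ s3Span k S) (e : Equiv.Perm (Fin 3)) :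
    (freeOperad k Unit).map e p ∈ s3Span k S := by
  induction hp using Submodule.span_induction with
  | zero => rw [map_zero]; exact zero_mem _
  | add p q _ _ hp hq => rw [map_add]; exact add_mem hp hq
  | smul c p _ hp => rw [map_smul]; exact Submodule.smul_mem _ _ hp
  | mem p hp =>
    obtain ⟨f, q, hq, rfl⟩ := Set.mem_iUnion.1 hp
    rw [← (freeOperad k Unit).map_trans]
    exact map_mem_s3Span k hq _

theorem s3Span_le {S T : Set ((freeOperad k Unit).obj (Fin 3))} (h : S ⊆ s3Span k T) :
    s3Span k S ≤ s3Span k T := by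
  refine Submodule.span_le.2 (Set.iUnion_subset fun e => ?_)
  rintro _ ⟨p, hp, rfl⟩
  exact map_s3Span_mem k (h hp) e

/-- In left symmetry with `x₂` and `x₃` exchanged, the monomials joining `x₂` last are `(x₁ x₃) x₂`
and `(x₃ x₁) x₂`. Right commutativity replaces them by `(x₁ x₂) x₃` and `(x₃ x₂) x₁`. The second
outer identity is right commutativity with `x₁` and `x₂` exchanged, so the substitution can be
undone. -/
theorem s3Span_novikovOuterRelations :
    s3Span k (novikovOuterRelations k) = s3Span k (novikovRelations k) := by
  refine le_antisymm (s3Span_le k ?_) (s3Span_le k ?_)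
  · have h1 (e) := map_mem_s3Span k (S := novikovRelations k) (Or.inl rfl : leftSymmetric k ∈ _) e
    have h2 (e) :=
      map_mem_s3Span k (S := novikovRelations k) (Or.inr rfl : rightCommutative k ∈ _) e
    simp only [leftSymmetric, rightCommutative, map_add, map_sub, map_leftMono,
      map_rightMono] at h1 h2
    have a : leftMono k 0 2 1 - rightMono k 0 2 1 - leftMono k 2 0 1 + rightMono k 2 0 1 ∈ _ :=
      h1 (Equiv.swap 1 2)
    have b : leftMono k 0 1 2 - leftMono k 0 2 1 ∈ _ := h2 (Equiv.refl _)
    have c : leftMono k 2 0 1 - leftMono k 2 1 0 ∈ _ := h2 (Equiv.swap 0 2 * Equiv.swap 1 2)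
    have d : leftMono k 1 0 2 - leftMono k 1 2 0 ∈ _ := h2 (Equiv.swap 0 1)
    rintro _ (rfl | rfl)
    · have h := add_mem a (add_mem b c)
      rw [SetLike.mem_coe]
      convert h using 1
      abel
    · exact d
  · have h1 (e) := map_mem_s3Span k (S := novikovOuterRelations k) (Or.inl rfl) e
    have h2 (e) := map_mem_s3Span k (S := novikovOuterRelations k) (Or.inr rfl) e
    simp only [map_add, map_sub, map_leftMono, map_rightMono] at h1 h2
    have a : leftMono k 0 2 1 - rightMono k 0 1 2 - leftMono k 1 2 0 + rightMono k 1 0 2 ∈ _ :=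
      h1 (Equiv.swap 1 2)
    have b : leftMono k 0 1 2 - leftMono k 0 2 1 ∈ _ := h2 (Equiv.swap 0 1)
    have c : leftMono k 1 0 2 - leftMono k 1 2 0 ∈ _ := h2 (Equiv.refl _)
    rintro _ (rfl | rfl)
    · have h := add_mem a (sub_mem b c)
      rw [SetLike.mem_coe]
      convert h using 1
      rw [leftSymmetric]
      abel
    · exact b

theorem leftMono_mem_treeShape (a b c : Fin 3) (h) : leftMono k a b c h ∈ treeShape k Unit c :=
  Submodule.subset_span ⟨(), _, _, h, Or.inl rfl, rfl⟩

theorem rightMono_mem_treeShape (a b c : Fin 3) (h) : rightMono k a b c h ∈ treeShape k Unit a :=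
  Submodule.subset_span ⟨(), _, _, h, Or.inr rfl, rfl⟩

theorem novikovOuterRelations_subset :
    novikovOuterRelations k ⊆ outerShapes k Unit := by
  have h2 : treeShape k Unit 2 ≤ outerShapes k Unit := le_sup_left
  have h0 : treeShape k Unit 0 ≤ outerShapes k Unit := le_sup_right
  rintro _ (rfl | rfl)
  · exact add_mem (sub_mem (sub_mem (h2 (leftMono_mem_treeShape k _ _ _ _))
      (h0 (rightMono_mem_treeShape k _ _ _ _))) (h0 (leftMono_mem_treeShape k _ _ _ _)))
      (h2 (rightMono_mem_treeShape k _ _ _ _))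
  · exact sub_mem (h2 (leftMono_mem_treeShape k _ _ _ _)) (h0 (leftMono_mem_treeShape k _ _ _ _))

theorem mk_eq_zero_of_mem_s3Span {Op : Type} {R : Set ((freeOperad k Op).obj (Fin 3))}
    {p : (freeOperad k Op).obj (Fin 3)} (hp : p ∈ s3Span k R) : quadraticOperad.mk R p = 0 :=
  (Submodule.Quotient.mk_eq_zero _).2
    (s3Span_le_idealSpan R ((freeOperad k Op).idealSpan R) (subset_idealSpan R) hp)

theorem mk_asRelations :
    quadraticOperad.mk (asRelations k) (leftMono k 0 1 2) =
      quadraticOperad.mk (asRelations k) (rightMono k 0 1 2) :=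
  sub_eq_zero.1 ((map_sub _ _ _).symm.trans
    (mk_eq_zero_of_mem_s3Span k (subset_s3Span (asRelations k) rfl)))

/-- Each monomial of the outer identities is the reading of a monomial in `≺`, `≻` whose leaves
spell `x₁ x₂ x₃`. By associativity these lifts share one first factor, so the white map sends the
lifted identity to that factor tensored with a Novikov relation. -/
theorem admitsNonsymmetricVersion_novikov : AdmitsNonsymmetricVersion k (novikovRelations k) := by
  refine admitsNonsymmetricVersion_of_s3Span _ (s3Span_novikovOuterRelations k) fun r hr => ?_
  have hmk := mk_eq_zero_of_mem_s3Span k (R := novikovRelations k)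
    (s3Span_novikovOuterRelations k ▸ subset_s3Span _ hr)
  -- In `L` and `M`, `b` selects the inner operation and `c` the outer one, with `true` for `≻`; `L`
  -- and `M` are the two bracketings of the word `x₁ x₂ x₃`.
  let L (b c : Bool) : (freeOperad k (Unit × Unit × Bool)).obj (Fin 3) :=
    mono k (.node ((), (), c) (.node ((), (), b) (.leaf 0) (.leaf 1)) (.leaf 2)) (by
      simp [OpTree.IsMultilinear, OpTree.leaves]; decide)
  let M (b c : Bool) : (freeOperad k (Unit × Unit × Bool)).obj (Fin 3) :=
    mono k (.node ((), (), c) (.leaf 0) (.node ((), (), b) (.leaf 1) (.leaf 2))) (by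
      simp [OpTree.IsMultilinear, OpTree.leaves]; decide)
  have hL : ∀ b c, whiteMap k (asRelations k) (novikovRelations k) (L b c) =
      quadraticOperad.mk (asRelations k) (leftMono k 0 1 2) ⊗ₜ[k]
        quadraticOperad.mk (novikovRelations k) ((sndHom k Unit Unit).app (Fin 3) (L b c)) := by
    intro b c
    simp only [L, mono_eq_freeTree, whiteMap_tree, sndHom_tree]
    rfl
  have hM : ∀ b c, whiteMap k (asRelations k) (novikovRelations k) (M b c) =
      quadraticOperad.mk (asRelations k) (leftMono k 0 1 2) ⊗ₜ[k]
        quadraticOperad.mk (novikovRelations k) ((sndHom k Unit Unit).app (Fin 3) (M b c)) := by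
    intro b c
    rw [mk_asRelations]
    simp only [M, mono_eq_freeTree, whiteMap_tree, sndHom_tree]
    rfl
  have hL' : (sndHom k Unit Unit).app (Fin 3) (L false false) = leftMono k 0 1 2 := sndHom_tree _ _
  have hM' : (sndHom k Unit Unit).app (Fin 3) (M true false) = rightMono k 0 2 1 := sndHom_tree _ _
  have hM'' : (sndHom k Unit Unit).app (Fin 3) (M true true) = leftMono k 2 1 0 := sndHom_tree _ _
  have hL'' : (sndHom k Unit Unit).app (Fin 3) (L false true) = rightMono k 2 0 1 :=
    sndHom_tree _ _
  have hL3 : (sndHom k Unit Unit).app (Fin 3) (L true false) = leftMono k 1 0 2 := sndHom_tree _ _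
  have hM3 : (sndHom k Unit Unit).app (Fin 3) (M false true) = leftMono k 1 2 0 := sndHom_tree _ _
  rcases hr with rfl | rfl
  -- The lift is `(x₁ ≺ x₂) ≺ x₃ - x₁ ≺ (x₂ ≻ x₃) - x₁ ≻ (x₂ ≻ x₃) + (x₁ ≺ x₂) ≻ x₃`.
  · refine ⟨L false false - M true false - M true true + L false true, ?_, ?_⟩
    · change whiteMap k (asRelations k) (novikovRelations k) _ = 0
      rw [map_add, map_sub, map_sub, hL, hM, hM, hL, hL', hM', hM'', hL'', ← TensorProduct.tmul_sub,
        ← TensorProduct.tmul_sub, ← TensorProduct.tmul_add, ← map_sub, ← map_sub, ← map_add, hmk,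
        TensorProduct.tmul_zero]
    · rw [map_add, map_sub, map_sub, hL', hM', hM'', hL'']
  -- The lift is `(x₁ ≻ x₂) ≺ x₃ - x₁ ≻ (x₂ ≺ x₃)`.
  · refine ⟨L true false - M false true, ?_, ?_⟩
    · change whiteMap k (asRelations k) (novikovRelations k) _ = 0
      rw [map_sub, hL, hM, hL3, hM3, ← TensorProduct.tmul_sub, ← map_sub, hmk,
        TensorProduct.tmul_zero]
    · rw [map_sub, hL3, hM3]

end Novikov

/-! ### Operadic ideals of the free operad in their lowest arity -/

section LowestArity

variable {k : Type u} [Field k] {Op A : Type} [Finite A]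

/-- A tree has at least one leaf. Without operations of arity 0, compositions cannot lower the
arity. -/
theorem freeOperad_eq_zero_of_isEmpty [IsEmpty A] (p : (freeOperad k Op).obj A) : p = 0 := by
  have h : (LinearMap.id : (freeOperad k Op).obj A →ₗ[k] _) = 0 :=
    freeOperad_linearMap_ext fun t _ =>
      isEmptyElim (List.head t.leaves t.leaves_ne_nil)
  exact LinearMap.congr_fun h p

/-- A product has at least two distinct leaves, so the only unary monomial is the variable itself.
-/
theorem exists_smul_one (e : Unit ≃ A) (p : (freeOperad k Op).obj A) :
    ∃ c : k, p = c • (freeOperad k Op).map e (freeOperad k Op).one := by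
  induction p using freeOperad_induction with
  | zero => exact ⟨0, by rw [zero_smul]⟩
  | add p q hp hq =>
    obtain ⟨c, hc⟩ := hp
    obtain ⟨d, hd⟩ := hq
    exact ⟨c + d, by rw [add_smul, ← hc, ← hd]⟩
  | smul a p hp =>
    obtain ⟨c, hc⟩ := hp
    exact ⟨a * c, by rw [mul_smul, ← hc]⟩
  | tree t ht =>
    refine ⟨1, ?_⟩
    rw [one_smul, freeOperad_one, freeOperad_map_tree]
    have hall : ∀ a : A, a = e () := fun a => e.symm.injective rfl
    cases t with
    | leaf a => simp only [hall a]; rfl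
    | node o l r =>
      have hd := (List.nodup_append'.1 (show (l.leaves ++ r.leaves).Nodup from ht.1)).2.2
      have h1 := List.head_mem l.leaves_ne_nil
      have h2 := List.head_mem r.leaves_ne_nil
      rw [hall (List.head _ _)] at h1 h2
      exact (hd h1 h2).elim

/-- The operadic ideal with a given `S_n`-stable component in arity `n` (in general, the largest
`S_n`-stable subspace), no nonzero elements in lower arities, and all elements in higher arities. -/
noncomputable def thresholdIdeal {n : ℕ} (S : Submodule k ((freeOperad k Op).obj (Fin n))) :
    OperadIdeal (freeOperad k Op) where
  carrier A _ :=
    { carrier := {p | (∀ e : A ≃ Fin n, (freeOperad k Op).map e p ∈ S) ∧ (Nat.card A < n → p = 0)}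
      add_mem' := fun {p q} hp hq => ⟨fun e => by
        rw [map_add]; exact add_mem (hp.1 e) (hq.1 e), fun h => by rw [hp.2 h, hq.2 h, add_zero]⟩
      zero_mem' := ⟨fun e => by rw [map_zero]; exact zero_mem _, fun _ => rfl⟩
      smul_mem' := fun c p hp => ⟨fun e => by
        rw [map_smul]; exact S.smul_mem c (hp.1 e), fun h => by rw [hp.2 h, smul_zero]⟩ }
  map_mem := by
    rintro A B _ _ e p ⟨h1, h2⟩
    refine ⟨fun f => ?_, fun h => ?_⟩
    · rw [← (freeOperad k Op).map_trans]
      exact h1 _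
    · rw [h2 (by rwa [Nat.card_congr e]), map_zero]
  comp_mem_left := by
    rintro A B _ _ p q ⟨h1, h2⟩
    -- Inserting a nullary operation would bring an element of arity `n + 1`, on which the ideal
    -- imposes no condition, down to arity `n`; no such nonzero operation exists.
    rcases isEmpty_or_nonempty B with hB | hB
    · rw [freeOperad_eq_zero_of_isEmpty q, map_zero]
      exact zero_mem _
    by_cases hA : Nat.card (Option A) < n
    · rw [h2 hA, map_zero, LinearMap.zero_apply]
      exact zero_mem _
    have hAn : n ≤ Nat.card A + 1 := by rw [← Finite.card_option]; omega
    have hB1 : 0 < Nat.card B := Nat.card_pos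
    refine ⟨fun e => ?_, fun h => ?_⟩
    · have hc : Nat.card (A ⊕ B) = n := by rw [Nat.card_congr e, Nat.card_fin]
      rw [Nat.card_sum] at hc
      -- The result has arity `n` and the outer operation has arity at least `n`, so `q` is unary, a
      -- multiple of the unit, and the composition is a rescaled relabelling of `p`.
      have hB2 : Nat.card B = 1 := by omega
      obtain ⟨f⟩ : Nonempty (Unit ≃ B) := Finite.card_eq.1 (by rw [hB2, Nat.card_unique])
      obtain ⟨c, rfl⟩ := exists_smul_one f q
      have h3 := (freeOperad k Op).map_comp (Equiv.refl A) f p (freeOperad k Op).one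
      have h4 := (freeOperad k Op).comp_one p
      have h5 : (freeOperad k Op).comp p (freeOperad k Op).one =
          (freeOperad k Op).map (sumUnitEquiv A).symm p := by
        conv_rhs => rw [← h4]
        rw [← (freeOperad k Op).map_trans, Equiv.self_trans_symm, (freeOperad k Op).map_refl]
      rw [Equiv.optionCongr_refl, (freeOperad k Op).map_refl] at h3
      rw [map_smul, ← h3, h5, map_smul, ← (freeOperad k Op).map_trans,
        ← (freeOperad k Op).map_trans]
      exact S.smul_mem c (h1 _)
    · rw [Nat.card_sum] at h
      omega
  comp_mem_right := by
    rintro A B _ _ p q ⟨h1, h2⟩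
    by_cases hB : Nat.card B < n
    · rw [h2 hB, map_zero]
      exact zero_mem _
    refine ⟨fun e => ?_, fun h => ?_⟩
    · have hc : Nat.card (A ⊕ B) = n := by rw [Nat.card_congr e, Nat.card_fin]
      rw [Nat.card_sum] at hc
      -- Symmetrically, the inner operation already uses all `n` inputs, so the outer one is a
      -- multiple of the unit.
      have hA : IsEmpty A := Finite.card_eq_zero_iff.1 (by omega)
      let g : Empty ≃ A := Equiv.equivOfIsEmpty _ _
      obtain ⟨c, rfl⟩ := exists_smul_one (unitOptionEquiv.trans (Equiv.optionCongr g)) p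
      have h3 := (freeOperad k Op).map_comp g (Equiv.refl B)
        ((freeOperad k Op).map unitOptionEquiv (freeOperad k Op).one) q
      have h5 : (freeOperad k Op).comp
          ((freeOperad k Op).map unitOptionEquiv (freeOperad k Op).one) q =
          (freeOperad k Op).map (Equiv.emptySum Empty B).symm q := by
        conv_rhs => rw [← (freeOperad k Op).one_comp q]
        rw [← (freeOperad k Op).map_trans, Equiv.self_trans_symm, (freeOperad k Op).map_refl]
      rw [(freeOperad k Op).map_refl, ← (freeOperad k Op).map_trans] at h3
      rw [map_smul, LinearMap.smul_apply, map_smul, ← h3, h5, ← (freeOperad k Op).map_trans,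
        ← (freeOperad k Op).map_trans]
      exact S.smul_mem c (h1 _)
    · rw [Nat.card_sum] at h
      omega

/-- Relations of arity `n` have no consequences in arity `n` beyond their `S_n`-span; the threshold
ideal of `S` contains `R` and witnesses this. -/
theorem idealSpan_le_of_perm_stable {n : ℕ} {R : Set ((freeOperad k Op).obj (Fin n))}
    (S : Submodule k ((freeOperad k Op).obj (Fin n)))
    (hS : ∀ (e : Equiv.Perm (Fin n)), ∀ p ∈ S, (freeOperad k Op).map e p ∈ S) (h : R ⊆ S) :
    ((freeOperad k Op).idealSpan R).carrier (Fin n) ≤ S := by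
  refine (idealSpan_le (I := thresholdIdeal S) (fun p hp => ?_) (Fin n)).trans fun p hp => ?_
  · exact ⟨fun e => hS e p (h hp), fun hc => by simp at hc⟩
  · exact (freeOperad k Op).map_refl p ▸ hp.1 (Equiv.refl _)

end LowestArity

/-! ### Coefficients -/

theorem OpTree.rename_symm_eq_iff {Op A B : Type} (e : A ≃ B) (s : OpTree Op A)
    (t : OpTree Op B) :
    s.rename e = t ↔ s = t.rename e.symm := by
  constructor
  · rintro rfl
    rw [OpTree.rename_rename, e.symm_comp_self]
    exact (OpTree.bind_leaf s).symm
  · rintro rfl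
    rw [OpTree.rename_rename, e.self_comp_symm]
    exact OpTree.bind_leaf t

section Coefficients

variable {k : Type u} [Field k] {Op A B : Type} [Finite A] [Finite B]

open Classical in
/-- The coefficient of a monomial in a multilinear polynomial. -/
noncomputable def treeCoeff (k : Type u) [Field k] (t : OpTree Op A) :
    (freeOperad k Op).obj A →ₗ[k] k :=
  freeLift fun s _ => if s = t then 1 else 0

open Classical in
theorem treeCoeff_tree (t s : OpTree Op A) (h : s.IsMultilinear) :
    treeCoeff k t (freeTree k s h) = if s = t then 1 else 0 :=
  freeLift_tree _ s h

theorem eq_zero_of_treeCoeff {p : (freeOperad k Op).obj A}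
    (h : ∀ t : OpTree Op A, t.IsMultilinear → treeCoeff k t p = 0) : p = 0 := by
  classical
  have key : ∀ (t : OpTree Op A) (ht : t.IsMultilinear),
      treeCoeff k t = (Finsupp.lapply (⟨t, ht⟩ : MultMonomial Op A) :
        (MultMonomial Op A →₀ k) →ₗ[k] k) := by
    intro t ht
    refine freeOperad_linearMap_ext fun s hs => ?_
    rw [treeCoeff_tree]
    refine Eq.trans ?_ (Finsupp.single_apply (a := (⟨s, hs⟩ : MultMonomial Op A))
      (a' := ⟨t, ht⟩) (b := (1 : k))).symm
    exact if_congr ⟨fun e => Subtype.ext e, fun e => congrArg Subtype.val e⟩ rfl rfl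
  refine Finsupp.ext (f := (p : MultMonomial Op A →₀ k)) (g := 0) fun t => ?_
  exact (LinearMap.congr_fun (key t.1 t.2) p).symm.trans (h t.1 t.2)

theorem treeCoeff_map (e : A ≃ B) (t : OpTree Op B) (p : (freeOperad k Op).obj A) :
    treeCoeff k t ((freeOperad k Op).map e p) = treeCoeff k (t.rename e.symm) p := by
  classical
  refine LinearMap.congr_fun (f := treeCoeff k t ∘ₗ (freeOperad k Op).map e)
    (freeOperad_linearMap_ext fun s hs => ?_) p
  simp only [LinearMap.comp_apply, freeOperad_map_tree, treeCoeff_tree,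
    OpTree.rename_symm_eq_iff]

end Coefficients

/-! ### The pre-Lie operad -/

namespace OpTree

/-- The monomial `(a b) c`. -/
def leftComb {X : Type} (a b c : X) : OpTree Unit X := node () (node () (leaf a) (leaf b)) (leaf c)

/-- The monomial `a (b c)`. -/
def rightComb {X : Type} (a b c : X) : OpTree Unit X := node () (leaf a) (node () (leaf b) (leaf c))

theorem IsMultilinear.leaves_length {Op : Type} {n : ℕ} {t : OpTree Op (Fin n)}
    (h : t.IsMultilinear) : t.leaves.length = n := by
  have h1 : t.leaves.toFinset = Finset.univ := Finset.eq_univ_of_forall fun a => by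
    simpa using h.2 a
  rw [← List.toFinset_card_of_nodup h.1, h1, Finset.card_fin]

theorem leaves_length_pos {Op X : Type} (t : OpTree Op X) : 0 < t.leaves.length :=
  List.length_pos_iff.2 t.leaves_ne_nil

theorem exists_eq_leaf {Op X : Type} {t : OpTree Op X} (h : t.leaves.length = 1) :
    ∃ a, t = leaf a := by
  cases t with
  | leaf a => exact ⟨a, rfl⟩
  | node o l r =>
    have h1 := l.leaves_length_pos
    have h2 := r.leaves_length_pos
    simp only [leaves, List.length_append] at h
    omega

theorem exists_eq_node {X : Type} {t : OpTree Unit X} (h : t.leaves.length = 2) :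
    ∃ a b, t = node () (leaf a) (leaf b) := by
  cases t with
  | leaf a => simp [leaves] at h
  | node o l r =>
    have h1 := l.leaves_length_pos
    have h2 := r.leaves_length_pos
    simp only [leaves, List.length_append] at h
    obtain ⟨a, rfl⟩ := exists_eq_leaf (t := l) (by omega)
    obtain ⟨b, rfl⟩ := exists_eq_leaf (t := r) (by omega)
    exact ⟨a, b, rfl⟩

theorem exists_eq_comb {X : Type} {t : OpTree Unit X} (h : t.leaves.length = 3) :
    ∃ a b c, t = leftComb a b c ∨ t = rightComb a b c := by
  cases t with
  | leaf a => simp [leaves] at h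
  | node o l r =>
    have h1 := l.leaves_length_pos
    have h2 := r.leaves_length_pos
    simp only [leaves, List.length_append] at h
    rcases (by omega : l.leaves.length = 1 ∨ l.leaves.length = 2) with hl | hl
    · obtain ⟨a, rfl⟩ := exists_eq_leaf hl
      obtain ⟨b, c, rfl⟩ := exists_eq_node (t := r) (by omega)
      exact ⟨a, b, c, Or.inr rfl⟩
    · obtain ⟨a, b, rfl⟩ := exists_eq_node hl
      obtain ⟨c, rfl⟩ := exists_eq_leaf (t := r) (by omega)
      exact ⟨a, b, c, Or.inl rfl⟩

/-- In a multilinear monomial of degree 3 the first or last variable is joined last. -/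
theorem IsMultilinear.comb_cases {t : OpTree Unit (Fin 3)} (h : t.IsMultilinear) :
    ∃ a b c : Fin 3, (∀ m, m = a ∨ m = b ∨ m = c) ∧ (t = leftComb a b c ∨ t = rightComb a b c) := by
  obtain ⟨a, b, c, hc⟩ := exists_eq_comb h.leaves_length
  refine ⟨a, b, c, fun m => ?_, hc⟩
  have hm := h.2 m
  rcases hc with rfl | rfl <;> simpa [leftComb, rightComb, leaves] using hm

end OpTree

open OpTree

/-- Gives finite dimension of `F_V(3)`, where a surjective endomorphism is injective. -/
instance finite_multMonomial_three : Finite (MultMonomial Unit (Fin 3)) := by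
  have h : Set.Finite {t : OpTree Unit (Fin 3) | t.IsMultilinear} := by
    refine ((Set.finite_range fun x : Fin 3 × Fin 3 × Fin 3 => leftComb x.1 x.2.1 x.2.2).union
      (Set.finite_range fun x : Fin 3 × Fin 3 × Fin 3 => rightComb x.1 x.2.1 x.2.2)).subset ?_
    intro t ht
    obtain ⟨a, b, c, -, rfl | rfl⟩ := IsMultilinear.comb_cases ht
    · exact Or.inl ⟨(a, b, c), rfl⟩
    · exact Or.inr ⟨(a, b, c), rfl⟩
  exact h.to_subtype

theorem finite_freeOperad_three (k : Type u) [Field k] :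
    Module.Finite k ((freeOperad k Unit).obj (Fin 3)) :=
  inferInstanceAs (Module.Finite k (MultMonomial Unit (Fin 3) →₀ k))

/-! ### Left symmetry in degree 3 and variables that are never joined last -/

section PreLie

variable (k : Type u) [Field k]

/-- The symmetries of the coefficients of the consequences of left symmetry in degree 3. -/
noncomputable def leftSymmetricSpace : Submodule k ((freeOperad k Unit).obj (Fin 3)) where
  carrier := {p | ∀ a b c, treeCoeff k (leftComb b a c) p = -treeCoeff k (leftComb a b c) p ∧
    treeCoeff k (rightComb a b c) p = -treeCoeff k (leftComb a b c) p}
  add_mem' hp hq a b c := by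
    simp only [map_add, (hp a b c).1, (hp a b c).2, (hq a b c).1, (hq a b c).2, neg_add, and_self]
  zero_mem' a b c := by simp only [map_zero, neg_zero, and_self]
  smul_mem' r p hp a b c := by
    simp only [map_smul, (hp a b c).1, (hp a b c).2, smul_neg, and_self]

theorem map_mem_leftSymmetricSpace (e : Equiv.Perm (Fin 3)) (p : (freeOperad k Unit).obj (Fin 3))
    (hp : p ∈ leftSymmetricSpace k) : (freeOperad k Unit).map e p ∈ leftSymmetricSpace k := by
  intro a b c
  simp only [treeCoeff_map]
  exact hp _ _ _

theorem leftSymmetric_mem : leftSymmetric k ∈ leftSymmetricSpace k := by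
  classical
  intro a b c
  simp only [leftSymmetric, leftMono, rightMono, mono_eq_freeTree, map_add, map_sub,
    treeCoeff_tree, leftComb, rightComb, OpTree.node.injEq, OpTree.leaf.injEq, true_and,
    reduceCtorEq, and_false, if_false]
  -- The 27 cases include repeated variables, for which all coefficients are zero.
  fin_cases a <;> fin_cases b <;> fin_cases c <;> simp

theorem idealSpan_preLie_le :
    ((freeOperad k Unit).idealSpan (preLieRelations k)).carrier (Fin 3) ≤ leftSymmetricSpace k :=
  idealSpan_le_of_perm_stable _ (map_mem_leftSymmetricSpace k)
    (by rintro _ rfl; exact leftSymmetric_mem k)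

theorem leftSymmetric_ne_zero : leftSymmetric k ≠ 0 := by
  classical
  intro h
  have h1 : treeCoeff k (leftComb 0 1 2) (leftSymmetric k) = 1 := by
    simp [leftSymmetric, leftMono, rightMono, mono_eq_freeTree, treeCoeff_tree, leftComb]
  rw [h, map_zero] at h1
  exact zero_ne_one h1

/-- The polynomials without monomials in which `m` is joined last. -/
noncomputable def avoidSpace (m : Fin 3) : Submodule k ((freeOperad k Unit).obj (Fin 3)) where
  carrier := {p | ∀ a b, treeCoeff k (leftComb a b m) p = 0 ∧ treeCoeff k (rightComb m a b) p = 0}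
  add_mem' hp hq a b := by
    simp only [map_add, (hp a b).1, (hp a b).2, (hq a b).1, (hq a b).2, add_zero, and_self]
  zero_mem' a b := by simp only [map_zero, and_self]
  smul_mem' r p hp a b := by simp only [map_smul, (hp a b).1, (hp a b).2, smul_zero, and_self]

/-- Up to sign, the coefficient of `(a b) c` equals those of `(b a) c`, `a (b c)` and `b (a c)`. In
these monomials each of `a`, `b`, `c` is joined last at least once, so whichever of them is `m`, the
common value is zero. -/
theorem eq_zero_of_mem_avoidSpace {p : (freeOperad k Unit).obj (Fin 3)}
    (hp : p ∈ leftSymmetricSpace k) {m : Fin 3} (hm : p ∈ avoidSpace k m) : p = 0 := by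
  refine eq_zero_of_treeCoeff fun t ht => ?_
  obtain ⟨a, b, c, h, ht⟩ := ht.comb_cases
  have hl : treeCoeff k (leftComb a b c) p = 0 := by
    rcases h m with rfl | rfl | rfl
    · exact neg_eq_zero.1 ((hp m b c).2.symm.trans (hm b c).2)
    · have h1 := neg_eq_zero.1 ((hp m a c).2.symm.trans (hm a c).2)
      rw [(hp m a c).1, h1, neg_zero]
    · exact (hm a b).1
  rcases ht with rfl | rfl
  · exact hl
  · rw [(hp a b c).2, hl, neg_zero]

theorem freeTree_mem_avoidSpace {m : Fin 3} {t : OpTree Unit (Fin 3)} (h : t.IsMultilinear)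
    (h1 : ∀ u, t ≠ node () u (leaf m)) (h2 : ∀ u, t ≠ node () (leaf m) u) :
    freeTree k t h ∈ avoidSpace k m := by
  classical
  intro a b
  rw [treeCoeff_tree, treeCoeff_tree]
  exact ⟨if_neg (h1 _), if_neg (h2 _)⟩

theorem treeShape_le_avoidSpace {c m : Fin 3} (hcm : c ≠ m) :
    treeShape k Unit c ≤ avoidSpace k m := by
  classical
  refine Submodule.span_le.2 ?_
  rintro _ ⟨o, u, t, h, ht, rfl⟩ a b
  rw [mono_eq_freeTree, treeCoeff_tree, treeCoeff_tree]
  rcases ht with rfl | rfl <;> simp [leftComb, rightComb, hcm]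

theorem outerShapes_le_avoidSpace : outerShapes k Unit ≤ avoidSpace k 1 :=
  sup_le (treeShape_le_avoidSpace k (by decide)) (treeShape_le_avoidSpace k (by decide))

/-- Elements of the form (T) avoid `x₂` as the variable joined last, so any such consequence of left
symmetry is zero and cannot generate a nonzero identity. -/
theorem not_writableInOuterShapes_preLie : ¬ WritableInOuterShapes k (preLieRelations k) := by
  rintro ⟨S, hS, h⟩
  have hle : s3Span k (preLieRelations k) ≤ leftSymmetricSpace k :=
    (s3Span_le_idealSpan _ _ (subset_idealSpan _)).trans (idealSpan_preLie_le k)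
  have h0 : ∀ p ∈ S, p = 0 := fun p hp =>
    eq_zero_of_mem_avoidSpace k (hle (h ▸ subset_s3Span S hp)) (outerShapes_le_avoidSpace k (hS hp))
  have h1 : leftSymmetric k ∈ s3Span k S := h ▸ subset_s3Span (preLieRelations k) rfl
  have h2 : s3Span k S ≤ ⊥ := by
    refine Submodule.span_le.2 (Set.iUnion_subset fun e => ?_)
    rintro _ ⟨p, hp, rfl⟩
    rw [h0 p hp, map_zero]
    exact zero_mem _
  exact leftSymmetric_ne_zero k ((Submodule.mem_bot k).1 (h2 h1))

/-- Reading `≻` backwards only exchanges branches, so a variable joined last in the reading is a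
branch at the root of `t` and stands at an end of its word. -/
theorem leaves_of_sndFactor_eq {X : Type} {t : OpTree (Unit × Unit × Bool) X} {m : X}
    {u : OpTree Unit X} (h : t.sndFactor = node () u (leaf m) ∨ t.sndFactor = node () (leaf m) u) :
    ∃ w, t.leaves = w ++ [m] ∨ t.leaves = m :: w := by
  have hleaf : ∀ s : OpTree (Unit × Unit × Bool) X, s.sndFactor = leaf m → s.leaves = [m] := by
    intro s hs
    cases s with
    | leaf x => cases hs; rfl
    | node o l r => obtain ⟨o₁, o₂, _ | _⟩ := o <;> cases hs
  cases t with
  | leaf x => rcases h with h | h <;> cases h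
  | node o l r =>
    have hcases : l.sndFactor = leaf m ∨ r.sndFactor = leaf m := by
      obtain ⟨o₁, o₂, _ | _⟩ := o <;> simp only [sndFactor, OpTree.node.injEq] at h <;> tauto
    rcases hcases with h | h
    · exact ⟨r.leaves, Or.inr (by simp [leaves, hleaf l h])⟩
    · exact ⟨l.leaves, Or.inl (by simp [leaves, hleaf r h])⟩

/-- The part of a polynomial with a given order of the variables does not contain, after
`x₁ ≻ x₂` is read as `x₂ x₁`, the monomials in which the middle variable is joined last. -/
theorem sndHom_wordPart_mem_avoidSpace (l : List (Fin 3)) :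
    ∃ m, ∀ p, (sndHom k Unit Unit).app (Fin 3) (wordPart k l p) ∈ avoidSpace k m := by
  have hl : ∃ m, ∀ t : OpTree (Unit × Unit × Bool) (Fin 3), t.IsMultilinear → t.leaves = l →
      ∀ w, l ≠ w ++ [m] ∧ l ≠ m :: w := by
    -- If `l` is the word of a multilinear monomial, `m` is its middle letter, which differs from
    -- both ends. Otherwise the part is zero and any `m` serves.
    by_cases h : ∃ t : OpTree (Unit × Unit × Bool) (Fin 3), t.IsMultilinear ∧ t.leaves = l
    · obtain ⟨t, ht, rfl⟩ := h
      obtain ⟨x, m, y, hxy⟩ := List.length_eq_three.1 ht.leaves_length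
      refine ⟨m, fun _ _ _ w => ?_⟩
      have hn := ht.1
      rw [hxy] at hn ⊢
      simp only [List.nodup_cons, List.mem_cons, List.not_mem_nil, or_false, not_or] at hn
      refine ⟨fun h => hn.2.1 ?_, fun h => hn.1.1 (List.cons.inj h).1⟩
      have h' := congrArg List.reverse h
      simp only [List.reverse_append, List.reverse_cons, List.reverse_nil, List.nil_append,
        List.cons_append] at h'
      exact (List.cons.inj h').1.symm
    · exact ⟨0, fun t ht htl => (h ⟨t, ht, htl⟩).elim⟩
  obtain ⟨m, hm⟩ := hl
  refine ⟨m, fun p => ?_⟩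
  induction p using freeOperad_induction with
  | zero => rw [map_zero, map_zero]; exact zero_mem _
  | add p q hp hq => rw [map_add, map_add]; exact add_mem hp hq
  | smul c p hp => rw [map_smul, map_smul]; exact Submodule.smul_mem _ _ hp
  | tree t ht =>
    rw [wordPart, freeLift_tree]
    split_ifs with htl
    · rw [sndHom_tree]
      refine freeTree_mem_avoidSpace k _ (fun u hu => ?_) (fun u hu => ?_)
      · obtain ⟨w, hw | hw⟩ := leaves_of_sndFactor_eq (Or.inl hu)
        · exact (hm t ht htl w).1 (htl.symm.trans hw)
        · exact (hm t ht htl w).2 (htl.symm.trans hw)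
      · obtain ⟨w, hw | hw⟩ := leaves_of_sndFactor_eq (Or.inr hu)
        · exact (hm t ht htl w).1 (htl.symm.trans hw)
        · exact (hm t ht htl w).2 (htl.symm.trans hw)
    · rw [map_zero]; exact zero_mem _

/-- Each word part reads as a pre-Lie relation in which the middle letter is never joined last,
hence as zero. -/
theorem sndHom_whiteRelations_preLie {p : (freeOperad k (Unit × Unit × Bool)).obj (Fin 3)}
    (hp : p ∈ whiteRelations k (asRelations k) (preLieRelations k)) :
    (sndHom k Unit Unit).app (Fin 3) p = 0 := by
  refine eq_zero_of_wordPart _ p fun l => ?_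
  obtain ⟨m, hm⟩ := sndHom_wordPart_mem_avoidSpace k l
  exact eq_zero_of_mem_avoidSpace k (idealSpan_preLie_le k
    ((Submodule.Quotient.mk_eq_zero _).1 (mk_sndHom_wordPart _ hp l))) (hm p)

/-- The identified product maps onto the free operad on one operation, too large in arity 3 for the
pre-Lie operad. Comparing dimensions rules out every isomorphism, including those that do not send
`≺` to the product. -/
theorem not_admitsNonsymmetricVersion_preLie :
    ¬ AdmitsNonsymmetricVersion k (preLieRelations k) := by
  rintro ⟨φ⟩
  let idHom : Hom (freeOperad k Unit) (freeOperad k Unit) :=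
    ⟨fun _ _ => LinearMap.id, fun _ _ => rfl, rfl, fun _ _ => rfl⟩
  obtain ⟨h, hh⟩ := exists_hom_identifiedProduct (preLieRelations k) idHom
    fun p hp => sndHom_whiteRelations_preLie k hp
  let ψ : (quadraticOperad k (preLieRelations k)).obj (Fin 3) →ₗ[k]
      (freeOperad k Unit).obj (Fin 3) := h.app (Fin 3) ∘ₗ (φ.equiv (Fin 3)).symm.toLinearMap
  -- A surjective endomorphism of `F_V(3)` that factors through the pre-Lie quotient: finite
  -- dimension makes it injective, yet it annihilates the left-symmetric identity.
  let θ := ψ ∘ₗ quadraticOperad.mk (preLieRelations k)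
  have hψ : Function.Surjective ψ := fun p =>
    ⟨φ.equiv (Fin 3) ((identifiedProj (preLieRelations k)).app (Fin 3)
      ((mapOpHom k fun _ => ((), (), false)).app (Fin 3) p)), by
      refine (congrArg (h.app (Fin 3)) ((φ.equiv (Fin 3)).symm_apply_apply _)).trans ?_
      exact (hh _ _).trans (sndHom_mapOpHom _ p)⟩
  have hθ : Function.Surjective θ := hψ.comp (Submodule.mkQ_surjective _)
  have := finite_freeOperad_three k
  have hinj : Function.Injective θ := LinearMap.injective_iff_surjective.2 hθ
  refine leftSymmetric_ne_zero k (hinj ?_)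
  have h0 : quadraticOperad.mk (preLieRelations k) (leftSymmetric k) = 0 :=
    mk_eq_zero_of_mem_s3Span k (subset_s3Span (preLieRelations k) rfl)
  rw [map_zero]
  exact (congrArg ψ h0).trans (map_zero ψ)

end PreLie

theorem mainTheorem4 (k : Type u) [Field k] :
    (¬ WritableInOuterShapes k (preLieRelations k) ∧
      ¬ AdmitsNonsymmetricVersion k (preLieRelations k)) ∧
    (novikovOuterRelations k ⊆ outerShapes k Unit ∧
      s3Span k (novikovOuterRelations k) = s3Span k (novikovRelations k) ∧
      WritableInOuterShapes k (novikovRelations k) ∧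
      AdmitsNonsymmetricVersion k (novikovRelations k)) :=
  ⟨⟨not_writableInOuterShapes_preLie k, not_admitsNonsymmetricVersion_preLie k⟩,
    novikovOuterRelations_subset k, s3Span_novikovOuterRelations k,
    ⟨_, novikovOuterRelations_subset k, s3Span_novikovOuterRelations k⟩,
    admitsNonsymmetricVersion_novikov k⟩
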